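/- For $x\in[0,1]$ let $H(x)=-x\log_2 x-(1-x)\log_2(1-x)$ be the binary entropy function (with $0\log_2 0=0$). There is exactly one $\delta\in(1/2,1]$ with $H(\delta)=2\delta-1$, and $\delta\approx 0.8295$ (correct to four decimal places). For $p\in[0,1]$ let $Q^n_p\subseteq\{0,1\}^n$ be the random subset that contains each point of $\{0,1\}^n$ independently with probability $p$, let $P_p=\operatorname{conv}(Q^n_p)\subset\mathbb{R}^n$ be the corresponding random $0/1$ polytope, and let $G_p$ be its graph: the vertices of $G_p$ are the vertices of $P_p$, and two distinct vertices $x,y$ are adjacent if and only if the segment $[x,y]$ is a face of $P_p$. Fix $\varepsilon>0$ and let $p=p(n)\in[0,1]$ be any sequence. 1. If $\varepsilon\le 1$ and $p(n)\le\left((1-\varepsilon)2^{-\delta}\right)^n$ for all sufficiently large $n$, then with probability tending to $1$ as $n\to\infty$, $G_p$ is a clique, i.e. any two distinct vertices of $G_p$ are adjacent. 2. If $p(n)\ge\left((1+\varepsilon)2^{-\delta}\right)^n$ for all sufficiently large $n$, then with probability tending to $1$ as $n\to\infty$, $G_p$ is not a clique. -/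

import Mathlib

open Filter Topology ProbabilityTheory

noncomputable section

/-- The binary entropy function (logarithms to base 2). -/
def binaryEntropy (x : ℝ) : ℝ :=
  -x * Real.logb 2 x - (1 - x) * Real.logb 2 (1 - x)

/-- `F` is a (nonempty) face of `P`: the set of points of `P` where some linear functional attains
its maximum over `P`. The zero functional is allowed, so `P` counts as a face of itself. -/
def IsFace {n : ℕ} (P F : Set (Fin n → ℝ)) : Prop :=
  F.Nonempty ∧ IsExposed ℝ P F

/-- The vertices of `P`: the points `x` such that `{x}` is a face of `P`. -/
def polytopeVertices {n : ℕ} (P : Set (Fin n → ℝ)) : Set (Fin n → ℝ) :=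
  {x | IsFace P {x}}

/-- The graph (1-skeleton) of `P`: two distinct vertices `x`, `y` of `P` are adjacent if and only
if the segment `[x, y]` is a (one-dimensional) face of `P`. -/
def polytopeGraph {n : ℕ} (P : Set (Fin n → ℝ)) : SimpleGraph (polytopeVertices P) where
  Adj x y := x ≠ y ∧ IsFace P (segment ℝ (x : Fin n → ℝ) (y : Fin n → ℝ))
  symm := ⟨fun x y h => ⟨h.1.symm, by
    rw [segment_symm]
    exact h.2⟩⟩
  loopless := ⟨fun _ h => h.1 rfl⟩

/-- A point of the Boolean hypercube `{0,1}^n`, as a point of `ℝ^n`. -/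
def cubePoint {n : ℕ} (x : Fin n → Bool) : Fin n → ℝ :=
  fun i => if x i then 1 else 0

/-- The 0/1 polytope `conv Q` of a subset `Q` of the hypercube. -/
def zeroOnePolytope {n : ℕ} (Q : Set (Fin n → Bool)) : Set (Fin n → ℝ) :=
  convexHull ℝ (cubePoint '' Q)

/-- The law of the random subset `Q_p^n` of the hypercube `{0,1}^n`, in which each point is
included independently with probability `p`. -/
def randomCubeSubset (n : ℕ) (p : unitInterval) : MeasureTheory.Measure (Set (Fin n → Bool)) :=
  setBernoulli (Set.univ : Set (Fin n → Bool)) p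

end

/-! Write `b = 2 ^ (-δ)`. The equation `H(δ) = 2δ - 1` says exactly `2 * 2 ^ H(δ) * b ^ 2 = 1`: at
`p = b ^ n` the expected number of pairs of `Q` at Hamming distance about `δ n` is neither
exponentially large nor exponentially small, while a subcube of that dimension holds about one point
of `Q`.

Below the threshold, pairs at distance at least `δ n` are absent by a Chernoff count. A closer pair
`x, y` that is not an edge has a set `S` of other points of `Q` with a strictly positive convex
combination on the line `xy` (`exists_crossesLine_of_not_isFace`), and `S` lies in the subcube
spanned by `x, y`. Large `S` are excluded because `2 ^ d * p ≤ (1 - ε) ^ n` makes subcubes sparse.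
Small `S` are excluded by counting: for fixed weights each coordinate at which `x, y` differ solves
one linear equation in `m + 1` bits, with at most `2 ^ m` solutions, so a pair at distance `d` has
only `O(2 ^ (m d))` sets of size `m + 1` (`card_filter_crossesLine_le`).

Above the threshold, take `d = ⌊(n + 1) δ⌋`. The second moment method gives a pair of `Q` at
distance `d`. Were its segment a face, some closed half-space bounded by a hyperplane through its
midpoint would contain no further point of `Q`. By antipodality it contains half of the subcube, and
by Sauer–Shelah there are only `2 ^ O(n ^ 2)` half-space traces, against a probability of order `exp
(-r ^ n / 4)` for each, where `r = 1 + ε`. -/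

open MeasureTheory

/-! ### Cylinder probabilities of the random subset. -/

section Bernoulli
variable {α : Type*}

lemma setBernoulli_univ_real_superset (p : unitInterval) (S : Finset α) :
    (setBernoulli (Set.univ : Set α) p).real {Q | (S : Set α) ⊆ Q} = (p : ℝ) ^ S.card := by
  have h : (fun q : α → Prop ↦ {i | q i}) ⁻¹' {Q | (S : Set α) ⊆ Q}
      = Set.pi S (fun _ => {True}) := by
    ext q
    simp [Set.subset_def, Set.mem_pi]
  rw [measureReal_def, setBernoulli_apply', h, Measure.infinitePi_pi _ (fun _ _ => by measurability)]
  simp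

lemma setBernoulli_univ_real_disjoint (p : unitInterval) (S : Finset α) :
    (setBernoulli (Set.univ : Set α) p).real {Q | ∀ x ∈ S, x ∉ Q} = (1 - (p : ℝ)) ^ S.card := by
  have h : (fun q : α → Prop ↦ {i | q i}) ⁻¹' {Q | ∀ x ∈ S, x ∉ Q}
      = Set.pi S (fun _ => {False}) := by
    ext q
    simp [Set.mem_pi]
  rw [measureReal_def, setBernoulli_apply', h, Measure.infinitePi_pi _ (fun _ _ => by measurability)]
  simp

end Bernoulli

/-! ### The entropy equation and the numerical value of `δ`. -/

lemma binaryEntropy_eq_div (x : ℝ) : binaryEntropy x = Real.binEntropy x / Real.log 2 := by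
  simp only [binaryEntropy, Real.binEntropy, Real.logb, Real.log_inv]
  ring

lemma strictAntiOn_binaryEntropy_sub :
    StrictAntiOn (fun x : ℝ => binaryEntropy x - (2 * x - 1)) (Set.Icc (1 / 2) 1) := by
  intro x hx y hy hxy
  have h := Real.binEntropy_strictAntiOn (a := x) (b := y) (by simpa using hx) (by simpa using hy) hxy
  have h2 : (0 : ℝ) < Real.log 2 := Real.log_pos (by norm_num)
  have h3 := div_lt_div_of_pos_right h h2
  simp only [binaryEntropy_eq_div]
  linarith

/-- Here `0.6589 = 2 * 0.82945 - 1`, so this is the sign of `H(x) - (2x - 1)` at the left end of the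
rounding interval for `δ`; `binaryEntropy_upper` treats the right end. -/
lemma binaryEntropy_lower : 0.6589 < binaryEntropy 0.82945 := by
  have h1 := Real.abs_log_sub_add_sum_range_le (x := 0.17055) (by norm_num [abs_lt]) 7
  have h2 := Real.abs_log_sub_add_sum_range_le (x := 0.3178) (by norm_num [abs_lt]) 11
  -- The series for `log (1 - x)` converges slowly near `x = 0.82945`; multiplying `0.17055` by 4
  -- moves the argument to `1 - 0.3178`, at the cost of `2 * log 2`.
  have h3 : Real.log (1 - 0.3178) = Real.log 0.17055 + 2 * Real.log 2 := by
    rw [show (1 - 0.3178 : ℝ) = 0.17055 * 2 ^ 2 by norm_num, Real.log_mul (by norm_num) (by norm_num),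
      Real.log_pow]
    norm_num
  rw [abs_le] at h1 h2
  rw [h3] at h2
  have e : (1 - 0.17055 : ℝ) = 0.82945 := by norm_num
  rw [e] at h1
  have h4 := Real.log_two_gt_d9
  have h5 := Real.log_two_lt_d9
  norm_num [Finset.sum_range_succ, abs_of_pos] at h1 h2
  rw [binaryEntropy_eq_div, lt_div_iff₀ (by linarith), Real.binEntropy, Real.log_inv, Real.log_inv]
  norm_num
  norm_num at h4 h5
  linarith [h1.1, h1.2, h2.1, h2.2]

lemma binaryEntropy_upper : binaryEntropy 0.82955 < 0.6591 := by
  have h1 := Real.abs_log_sub_add_sum_range_le (x := 0.17045) (by norm_num [abs_lt]) 7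
  have h2 := Real.abs_log_sub_add_sum_range_le (x := 0.3182) (by norm_num [abs_lt]) 11
  have h3 : Real.log (1 - 0.3182) = Real.log 0.17045 + 2 * Real.log 2 := by
    rw [show (1 - 0.3182 : ℝ) = 0.17045 * 2 ^ 2 by norm_num, Real.log_mul (by norm_num) (by norm_num),
      Real.log_pow]
    norm_num
  rw [abs_le] at h1 h2
  rw [h3] at h2
  have e : (1 - 0.17045 : ℝ) = 0.82955 := by norm_num
  rw [e] at h1
  have h4 := Real.log_two_gt_d9
  have h5 := Real.log_two_lt_d9
  norm_num [Finset.sum_range_succ, abs_of_pos] at h1 h2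
  rw [binaryEntropy_eq_div, div_lt_iff₀ (by linarith), Real.binEntropy, Real.log_inv, Real.log_inv]
  norm_num
  norm_num at h4 h5
  linarith [h1.1, h1.2, h2.1, h2.2]

lemma continuous_binaryEntropy : Continuous binaryEntropy := by
  have : binaryEntropy = fun x => Real.binEntropy x / Real.log 2 := funext binaryEntropy_eq_div
  rw [this]
  exact Real.binEntropy_continuous.div_const _

lemma existsUnique_binaryEntropy_eq :
    ∃! δ : ℝ, δ ∈ Set.Ioc (1 / 2 : ℝ) 1 ∧ binaryEntropy δ = 2 * δ - 1 := by
  obtain ⟨δ, hδ, h⟩ := intermediate_value_Icc' (a := (0.82945 : ℝ)) (b := 0.82955) (by norm_num)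
    ((continuous_binaryEntropy.sub (by fun_prop : Continuous fun x : ℝ => 2 * x - 1)).continuousOn)
    (show (0 : ℝ) ∈ _ from ⟨by
      have := binaryEntropy_upper
      norm_num at this ⊢
      linarith, by
      have := binaryEntropy_lower
      norm_num at this ⊢
      linarith⟩)
  refine ⟨δ, ⟨⟨?_, ?_⟩, sub_eq_zero.1 h⟩, ?_⟩
  · have := hδ.1
    norm_num at this ⊢
    linarith
  · have := hδ.2
    norm_num at this ⊢
    linarith
  · rintro δ' ⟨hδ', h'⟩
    refine strictAntiOn_binaryEntropy_sub.injOn ⟨hδ'.1.le, hδ'.2⟩ ⟨?_, ?_⟩ ?_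
    · have := hδ.1
      norm_num at this ⊢
      linarith
    · have := hδ.2
      norm_num at this ⊢
      linarith
    · exact (sub_eq_zero.2 h').trans h.symm

lemma abs_sub_lt_of_binaryEntropy_eq {δ : ℝ} (hδ : δ ∈ Set.Ioc (1 / 2 : ℝ) 1)
    (h : binaryEntropy δ = 2 * δ - 1) : |δ - 0.8295| < 0.00005 := by
  have hm : δ ∈ Set.Icc (1 / 2 : ℝ) 1 := ⟨hδ.1.le, hδ.2⟩
  have h1 : (0.82945 : ℝ) < δ := by
    refine (strictAntiOn_binaryEntropy_sub.lt_iff_gt hm (by norm_num)).1 ?_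
    have := binaryEntropy_lower
    simp only [h]
    norm_num at this ⊢
    linarith
  have h2 : δ < (0.82955 : ℝ) := by
    refine (strictAntiOn_binaryEntropy_sub.lt_iff_gt (by norm_num) hm).1 ?_
    have := binaryEntropy_upper
    simp only [h]
    norm_num at this ⊢
    linarith
  rw [abs_lt]
  constructor
  · norm_num at h1 ⊢
    linarith
  · norm_num at h2 ⊢
    linarith

/-! ### Faces of 0/1 polytopes. -/

/-- A maximiser of `l` splits as a convex combination of a point of `convexHull F`, where `l = c`,
and one of `convexHull (T \ F)`, where `l < c`; the second weight must vanish. -/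
lemma isExposed_convexHull_of_forall_lt {E : Type*} [AddCommGroup E] [Module ℝ E]
    [TopologicalSpace E] {T F : Set E} (hFT : F ⊆ T) (hF : F.Nonempty) (l : StrongDual ℝ E) (c : ℝ)
    (h1 : ∀ z ∈ F, l z = c) (h2 : ∀ z ∈ T, z ∉ F → l z < c) :
    IsExposed ℝ (convexHull ℝ T) (convexHull ℝ F) := by
  intro _
  refine ⟨l, ?_⟩
  have hle : ∀ v ∈ convexHull ℝ T, l v ≤ c := by
    intro v hv
    have : convexHull ℝ T ⊆ {v | l v ≤ c} :=
      convexHull_min (fun z hz => by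
        by_cases hzF : z ∈ F
        · exact (h1 z hzF).le
        · exact (h2 z hz hzF).le) (convex_halfSpace_le l.isLinear c)
    exact this hv
  have hFc : ∀ v ∈ convexHull ℝ F, l v = c := by
    intro v hv
    have : convexHull ℝ F ⊆ {v | l v = c} :=
      convexHull_min (fun z hz => h1 z hz) (convex_hyperplane l.isLinear c)
    exact this hv
  ext w
  constructor
  · intro hw
    exact ⟨convexHull_mono hFT hw, fun v hv => (hle v hv).trans (hFc w hw).ge⟩
  · rintro ⟨hw, hmax⟩
    obtain ⟨z₀, hz₀⟩ := hF
    have hwc : l w = c :=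
      le_antisymm (hle w hw) ((h1 z₀ hz₀).ge.trans (hmax z₀ (subset_convexHull ℝ T (hFT hz₀))))
    have hu : T = F ∪ (T \ F) := (Set.union_sdiff_cancel hFT).symm
    by_cases hemp : (T \ F).Nonempty
    · rw [hu, convexHull_union ⟨z₀, hz₀⟩ hemp, mem_convexJoin] at hw
      obtain ⟨a, ha, b, hb, hab⟩ := hw
      have hb' : l b < c := by
        have : convexHull ℝ (T \ F) ⊆ {v | l v < c} :=
          convexHull_min (fun z hz => h2 z hz.1 hz.2) (convex_halfSpace_lt l.isLinear c)
        exact this hb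
      have ha' := hFc a ha
      obtain ⟨s, t, hs, ht, hst, rfl⟩ := hab
      simp only [map_add, map_smul, smul_eq_mul, ha'] at hwc
      have hs1 : s = 1 - t := by linarith
      subst hs1
      have ht0 : t = 0 := by
        have : t * (c - l b) = 0 := by linarith
        rcases mul_eq_zero.1 this with h | h
        · exact h
        · linarith
      subst ht0
      simpa using ha
    · rw [Set.not_nonempty_iff_eq_empty, Set.sdiff_eq_empty] at hemp
      exact convexHull_mono hemp hw

section Cube
variable {n : ℕ}

lemma cubePoint_injective : Function.Injective (cubePoint (n := n)) := by
  intro x y h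
  ext j
  have := congrFun h j
  unfold cubePoint at this
  cases hx : x j <;> cases hy : y j <;> simp_all

lemma isFace_singleton_cubePoint {Q : Set (Fin n → Bool)} {x : Fin n → Bool} (hx : x ∈ Q) :
    IsFace (zeroOnePolytope Q) {cubePoint x} := by
  refine ⟨Set.singleton_nonempty _, ?_⟩
  rw [← convexHull_singleton (𝕜 := ℝ) (cubePoint x)]
  -- Up to a constant, `l` is minus the Hamming distance to `x` on cube points.
  let l : StrongDual ℝ (Fin n → ℝ) :=
    ∑ j, (if x j then (1 : ℝ) else -1) • ContinuousLinearMap.proj (R := ℝ) (φ := fun _ => ℝ) j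
  have hl : ∀ v, l v = ∑ j, (if x j then (1 : ℝ) else -1) * v j := fun v => by
    simp only [l, sum_apply]
    rfl
  refine isExposed_convexHull_of_forall_lt (by simpa using ⟨x, hx, rfl⟩)
    (Set.singleton_nonempty _) l (l (cubePoint x)) (by simp) ?_
  rintro _ ⟨z, hz, rfl⟩ hne
  have hne' : z ≠ x := fun h => hne (by simp [h])
  obtain ⟨j, hj⟩ := Function.ne_iff.1 hne'
  rw [hl, hl]
  refine Finset.sum_lt_sum (fun i _ => ?_) ⟨j, Finset.mem_univ _, ?_⟩
  · unfold cubePoint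
    cases x i <;> cases z i <;> simp
  · unfold cubePoint
    cases hx : x j <;> cases hz : z j <;> simp_all

lemma polytopeVertices_zeroOnePolytope (Q : Set (Fin n → Bool)) :
    polytopeVertices (zeroOnePolytope Q) = cubePoint '' Q := by
  apply Set.Subset.antisymm
  · intro v hv
    have h1 : IsExtreme ℝ (zeroOnePolytope Q) {v} := hv.2.isExtreme
    exact extremePoints_convexHull_subset (isExtreme_singleton.1 h1)
  · rintro _ ⟨x, hx, rfl⟩
    exact isFace_singleton_cubePoint hx

lemma polytopeGraph_eq_top_iff (Q : Set (Fin n → Bool)) :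
    polytopeGraph (zeroOnePolytope Q) = ⊤ ↔ ∀ x ∈ Q, ∀ y ∈ Q, x ≠ y →
      IsFace (zeroOnePolytope Q) (segment ℝ (cubePoint x) (cubePoint y)) := by
  constructor
  · intro h x hx y hy hxy
    have hadj : (polytopeGraph (zeroOnePolytope Q)).Adj ⟨cubePoint x, isFace_singleton_cubePoint hx⟩
        ⟨cubePoint y, isFace_singleton_cubePoint hy⟩ := by
      rw [h]
      exact fun h => hxy (cubePoint_injective (Subtype.ext_iff.1 h))
    exact hadj.2
  · intro h
    ext ⟨v, hv⟩ ⟨w, hw⟩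
    rw [SimpleGraph.top_adj]
    refine ⟨fun h => h.1, fun hne => ⟨hne, ?_⟩⟩
    rw [polytopeVertices_zeroOnePolytope] at hv hw
    obtain ⟨x, hx, rfl⟩ := hv
    obtain ⟨y, hy, rfl⟩ := hw
    exact h x hx y hy (fun h => hne (by simp [h]))

/-- Some convex combination with full support on `S` lies on the line through `x` and `y`. -/
def CrossesLine (x y : Fin n → Bool) (S : Finset (Fin n → Bool)) : Prop :=
  ∃ (w : (Fin n → Bool) → ℝ) (t : ℝ), (∀ s ∈ S, 0 < w s) ∧ ∑ s ∈ S, w s = 1 ∧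
    ∀ j, ∑ s ∈ S, w s * cubePoint s j = cubePoint x j + t * (cubePoint y j - cubePoint x j)

/-- If the hull of the other points of `Q` misses the line `xy`, a functional separates them
strictly. Being bounded below on the whole line, it is constant there, so it exposes the segment.
Otherwise a common point gives `S` as the support of its weights. -/
lemma exists_crossesLine_of_not_isFace {Q : Set (Fin n → Bool)} {x y : Fin n → Bool}
    (hx : x ∈ Q) (hy : y ∈ Q)
    (h : ¬ IsFace (zeroOnePolytope Q) (segment ℝ (cubePoint x) (cubePoint y))) :
    ∃ S : Finset (Fin n → Bool), ↑S ⊆ Q ∧ x ∉ S ∧ y ∉ S ∧ CrossesLine x y S := by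
  classical
  set R : Finset (Fin n → Bool) := Finset.univ.filter (fun z => z ∈ Q ∧ z ≠ x ∧ z ≠ y) with hR
  set T : Finset (Fin n → ℝ) := R.image cubePoint with hT
  set L : AffineSubspace ℝ (Fin n → ℝ) := line[ℝ, cubePoint x, cubePoint y] with hL
  have hmem : ∀ t : ℝ, AffineMap.lineMap (cubePoint x) (cubePoint y) t ∈ L := fun t =>
    AffineMap.lineMap_mem_affineSpan_pair t _ _
  by_cases hd : Disjoint (convexHull ℝ (T : Set (Fin n → ℝ))) (L : Set (Fin n → ℝ))
  · exfalso
    obtain ⟨l, u, v, hu, huv, hv⟩ := geometric_hahn_banach_compact_closed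
      (convex_convexHull ℝ (T : Set (Fin n → ℝ)))
      ((Finset.finite_toSet T).isCompact_convexHull ℝ) L.convex
      (AffineSubspace.closed_of_finiteDimensional L) hd
    have hline : ∀ t : ℝ, v < l (cubePoint x) + t * (l (cubePoint y) - l (cubePoint x)) := by
      intro t
      have := hv _ (hmem t)
      rw [AffineMap.lineMap_apply_module'] at this
      simp only [map_add, map_smul, map_sub, smul_eq_mul] at this
      linarith
    have heq : l (cubePoint y) = l (cubePoint x) := by
      by_contra hne
      have hne' : l (cubePoint y) - l (cubePoint x) ≠ 0 := sub_ne_zero.2 hne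
      -- At this parameter the non-constant functional takes the value `v`, against the strict
      -- bound.
      have := hline ((v - l (cubePoint x)) / (l (cubePoint y) - l (cubePoint x)))
      rw [div_mul_cancel₀ _ hne'] at this
      linarith
    apply h
    refine ⟨⟨_, left_mem_segment ℝ _ _⟩, ?_⟩
    rw [← convexHull_pair]
    refine isExposed_convexHull_of_forall_lt ?_ ⟨_, Set.mem_insert _ _⟩ l (l (cubePoint x)) ?_ ?_
    · rintro z (rfl | rfl)
      · exact ⟨x, hx, rfl⟩
      · exact ⟨y, hy, rfl⟩
    · rintro z (rfl | rfl)
      · rfl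
      · exact heq
    · rintro _ ⟨z, hz, rfl⟩ hne
      have hzT : cubePoint z ∈ (T : Set (Fin n → ℝ)) := by
        rw [hT, Finset.mem_coe]
        refine Finset.mem_image_of_mem _ ?_
        rw [hR, Finset.mem_filter]
        refine ⟨Finset.mem_univ _, hz, ?_, ?_⟩
        · rintro rfl
          exact hne (by simp)
        · rintro rfl
          exact hne (by simp)
      have h1 := hu _ (subset_convexHull ℝ _ hzT)
      have h2 := hline 0
      linarith
  · rw [Set.not_disjoint_iff] at hd
    obtain ⟨a, ha, haL⟩ := hd
    rw [Finset.mem_convexHull'] at ha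
    obtain ⟨w, hw0, hw1, hwa⟩ := ha
    have haL' : a ∈ L := haL
    rw [hL, mem_affineSpan_pair_iff_exists_lineMap_eq] at haL'
    obtain ⟨t, rfl⟩ := haL'
    rw [hT, Finset.sum_image (fun _ _ _ _ h => cubePoint_injective h)] at hw1 hwa
    have hw0' : ∀ s ∈ R, 0 ≤ w (cubePoint s) := fun s hs => hw0 _ (Finset.mem_image_of_mem _ hs)
    refine ⟨R.filter (fun s => 0 < w (cubePoint s)), ?_, ?_, ?_, fun s => w (cubePoint s), t, ?_,
      ?_, ?_⟩
    · intro s hs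
      simp [hR] at hs
      exact hs.1.1
    · simp [hR]
    · simp [hR]
    · intro s hs
      exact (Finset.mem_filter.1 hs).2
    · rw [← hw1]
      refine Finset.sum_subset (Finset.filter_subset _ _) (fun s hs hs' => ?_)
      have : ¬ 0 < w (cubePoint s) := fun h => hs' (Finset.mem_filter.2 ⟨hs, h⟩)
      linarith [hw0' s hs]
    · intro j
      have h1 := congrFun hwa j
      rw [AffineMap.lineMap_apply_module'] at h1
      simp only [Finset.sum_apply, Pi.smul_apply, smul_eq_mul, Pi.add_apply, Pi.sub_apply] at h1
      rw [add_comm, ← h1]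
      refine Finset.sum_subset (Finset.filter_subset _ _) (fun s hs hs' => ?_)
      have : ¬ 0 < w (cubePoint s) := fun h => hs' (Finset.mem_filter.2 ⟨hs, h⟩)
      have h0 : w (cubePoint s) = 0 := by linarith [hw0' s hs]
      simp [h0]

/-- The vertices of the smallest face of the cube that contains `x` and `y`. -/
def subcube (x y : Fin n → Bool) : Finset (Fin n → Bool) :=
  Fintype.piFinset (fun j => if x j = y j then {x j} else Finset.univ)

lemma mem_subcube {x y z : Fin n → Bool} : z ∈ subcube x y ↔ ∀ j, x j = y j → z j = x j := by
  rw [subcube, Fintype.mem_piFinset]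
  refine forall_congr' fun j => ?_
  split_ifs with h <;> simp [h]

lemma card_subcube (x y : Fin n → Bool) : (subcube x y).card = 2 ^ hammingDist x y := by
  rw [subcube, Fintype.card_piFinset, hammingDist, ← Finset.prod_const, Finset.prod_filter]
  refine Finset.prod_congr rfl fun j _ => ?_
  by_cases h : x j = y j <;> simp [h]

/-- Where `x` and `y` agree, the weighted average of bits is 0 or 1, an extreme value; positive
weights force every bit to equal it. -/
lemma CrossesLine.subset_subcube {x y : Fin n → Bool} {S : Finset (Fin n → Bool)}
    (h : CrossesLine x y S) : S ⊆ subcube x y := by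
  obtain ⟨w, t, hw, hw1, hS⟩ := h
  intro s hs
  rw [mem_subcube]
  intro j hj
  have h1 := hS j
  have hxy : cubePoint y j = cubePoint x j := by simp [cubePoint, hj]
  rw [hxy, sub_self, mul_zero, add_zero] at h1
  have h2 : ∑ s ∈ S, w s * |cubePoint s j - cubePoint x j| = 0 := by
    cases hx : x j
    · have : ∀ s : Fin n → Bool, |cubePoint s j - cubePoint x j| = cubePoint s j := by
        intro s
        cases hs : s j <;> simp [cubePoint, hx, hs]
      simp_rw [this, h1]
      simp [cubePoint, hx]
    · have : ∀ s : Fin n → Bool, |cubePoint s j - cubePoint x j| = 1 - cubePoint s j := by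
        intro s
        cases hs : s j <;> simp [cubePoint, hx, hs]
      simp_rw [this, mul_sub, Finset.sum_sub_distrib, h1, mul_one, hw1]
      simp [cubePoint, hx]
  rw [Finset.sum_eq_zero_iff_of_nonneg (fun s hs => mul_nonneg (hw s hs).le (abs_nonneg _))] at h2
  have h3 := h2 s hs
  have h4 : cubePoint s j = cubePoint x j := by
    rcases mul_eq_zero.1 h3 with h | h
    · exact absurd h (hw s hs).ne'
    · linarith [abs_eq_zero.1 h]
  cases hx : x j <;> cases hs : s j <;> simp_all [cubePoint]

lemma CrossesLine.two_le_card {x y : Fin n → Bool} {S : Finset (Fin n → Bool)}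
    (h : CrossesLine x y S) (hxy : x ≠ y) (hx : x ∉ S) (hy : y ∉ S) : 2 ≤ S.card := by
  have hsub := h.subset_subcube
  obtain ⟨w, t, hw, hw1, hS⟩ := h
  by_contra hlt
  have : S.card = 0 ∨ S.card = 1 := by omega
  rcases this with h0 | h1
  · rw [Finset.card_eq_zero] at h0
    simp [h0] at hw1
  · obtain ⟨s, rfl⟩ := Finset.card_eq_one.1 h1
    simp only [Finset.sum_singleton] at hw1 hS
    rw [hw1] at hS
    simp only [one_mul] at hS
    obtain ⟨i, hi⟩ := Function.ne_iff.1 hxy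
    have hs := mem_subcube.1 (hsub (Finset.mem_singleton_self s))
    rw [Finset.mem_singleton] at hx hy
    have ht : t = 0 ∨ t = 1 := by
      have := hS i
      cases hxi : x i <;> cases hyi : y i <;> cases hsi : s i <;> simp_all [cubePoint]
      right
      linarith
    rcases ht with rfl | rfl
    · exact hx (cubePoint_injective (by ext j; simp [hS j]))
    · exact hy (cubePoint_injective (by ext j; simp [hS j]))

/-- The segment has no cube points besides its ends, so the exposing functional is strictly smaller
on the rest of `Q`. Hence the midpoint lies outside the hull of the rest and is separated from it by
`g`. -/
lemma exists_halfSpace_of_isFace_segment {Q : Set (Fin n → Bool)} {x y : Fin n → Bool}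
    (h : IsFace (zeroOnePolytope Q) (segment ℝ (cubePoint x) (cubePoint y))) :
    ∃ g : StrongDual ℝ (Fin n → ℝ), ∀ z ∈ Q, z ≠ x → z ≠ y →
      g (cubePoint x) + g (cubePoint y) < 2 * g (cubePoint z) := by
  obtain ⟨l, hl⟩ := h.2 h.1
  set c := midpoint ℝ (cubePoint x) (cubePoint y) with hc
  have hcm : c ∈ segment ℝ (cubePoint x) (cubePoint y) := midpoint_mem_segment _ _
  have hcF := hcm
  rw [hl] at hcF
  set T : Set (Fin n → ℝ) := cubePoint '' (Q \ {x, y}) with hT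
  have hlt : ∀ z ∈ Q, z ≠ x → z ≠ y → l (cubePoint z) < l c := by
    intro z hz hzx hzy
    have hzP : cubePoint z ∈ zeroOnePolytope Q := subset_convexHull ℝ _ ⟨z, hz, rfl⟩
    refine lt_of_le_of_ne (hcF.2 _ hzP) fun heq => ?_
    have hzs : cubePoint z ∈ segment ℝ (cubePoint x) (cubePoint y) := by
      rw [hl]
      exact ⟨hzP, fun v hv => (hcF.2 v hv).trans heq.ge⟩
    have hS : CrossesLine x y {z} := by
      obtain ⟨a, b, ha, hb, hab, heq⟩ := hzs
      refine ⟨fun _ => 1, b, by simp, by simp, fun j => ?_⟩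
      simp only [Finset.sum_singleton, ← heq, Pi.add_apply, Pi.smul_apply, smul_eq_mul]
      have : a = 1 - b := by linarith
      rw [this]
      ring
    by_cases hxy : x = y
    · subst hxy
      have := mem_subcube.1 (hS.subset_subcube (Finset.mem_singleton_self z))
      exact hzx (funext fun j => this j rfl)
    · have := hS.two_le_card hxy (by simpa using hzx.symm) (by simpa using hzy.symm)
      simp at this
  have hnot : c ∉ convexHull ℝ T := by
    intro hcT
    have : convexHull ℝ T ⊆ {v | l v < l c} := by
      refine convexHull_min ?_ (convex_halfSpace_lt l.isLinear _)
      rintro _ ⟨z, ⟨hz, hne⟩, rfl⟩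
      simp only [Set.mem_insert_iff, Set.mem_singleton_iff, not_or] at hne
      exact hlt z hz hne.1 hne.2
    exact (lt_irrefl (l c)) (this hcT)
  obtain ⟨g, u, hgu, hg⟩ := geometric_hahn_banach_point_closed (convex_convexHull ℝ T)
    ((Set.toFinite T).isClosed_convexHull ℝ) hnot
  refine ⟨g, fun z hz hzx hzy => ?_⟩
  have h1 := hg _ (subset_convexHull ℝ T ⟨z, ⟨hz, by simp [hzx, hzy]⟩, rfl⟩)
  have h2 : g c = (1 / 2) * (g (cubePoint x) + g (cubePoint y)) := by
    rw [hc, midpoint_eq_smul_add]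
    simp [mul_add]
  linarith

end Cube

/-! ### Counting the sets that cross a line. -/

/-- Since `w 0 ≠ 0`, the other bits determine bit 0. -/
lemma card_filter_sum_eq_le {m : ℕ} (w : Fin (m + 1) → ℝ) (hw : ∀ a, 0 < w a) (t : ℝ) :
    (Finset.univ.filter
      (fun r : Fin (m + 1) → Bool => ∑ a, w a * (if r a then 1 else 0) = t)).card ≤ 2 ^ m := by
  have h : (2 : ℕ) ^ m = (Finset.univ : Finset (Fin m → Bool)).card := by simp
  rw [h]
  refine Finset.card_le_card_of_injOn (fun r => Fin.tail r) (fun _ _ => Finset.mem_coe.2 (Finset.mem_univ _)) ?_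
  intro r hr r' hr' heq
  simp only [Finset.coe_filter, Finset.mem_univ, true_and, Set.mem_ofPred_eq] at hr hr'
  rw [Fin.sum_univ_succ] at hr hr'
  have ht : ∀ a : Fin m, r a.succ = r' a.succ := fun a => congrFun heq a
  simp only [ht] at hr
  have h0 : w 0 * (if r 0 then 1 else 0) = w 0 * (if r' 0 then 1 else 0) := by linarith
  have h0' := mul_left_cancel₀ (hw 0).ne' h0
  funext a
  refine Fin.cases ?_ ht a
  cases h1 : r 0 <;> cases h2 : r' 0 <;> simp_all

/-- View `S` as `n` vectors of `m + 1` bits, one per coordinate. A coordinate with `x j = y j` is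
forced; otherwise its vector solves `∑ w r = t` or `∑ w r = 1 - t`. The real data `(w, t)` matter
only through the two solution sets, which explains the two factors `2 ^ 2 ^ (m + 1)`. -/
lemma card_filter_crossesLine_le {n : ℕ} (x y : Fin n → Bool) (m : ℕ)
    [DecidablePred (fun S : Finset (Fin n → Bool) => S.card = m + 1 ∧ CrossesLine x y S)] :
    (Finset.univ.filter (fun S : Finset (Fin n → Bool) => S.card = m + 1 ∧ CrossesLine x y S)).card
      ≤ (2 ^ 2 ^ (m + 1)) * (2 ^ 2 ^ (m + 1)) * (2 ^ m) ^ hammingDist x y := by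
  classical
  let Rs : Finset (Finset (Fin (m + 1) → Bool)) := Finset.univ.filter (fun R => R.card ≤ 2 ^ m)
  let rows : Finset (Fin (m + 1) → Bool) × Finset (Fin (m + 1) → Bool) → Fin n →
      Finset (Fin (m + 1) → Bool) := fun p j =>
    if x j = y j then {fun _ => x j} else if x j then p.2 else p.1
  let toSet : (Fin n → Fin (m + 1) → Bool) → Finset (Fin n → Bool) := fun u =>
    Finset.univ.image (fun a j => u j a)
  have hsub : Finset.univ.filter
      (fun S : Finset (Fin n → Bool) => S.card = m + 1 ∧ CrossesLine x y S) ⊆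
      ((Rs ×ˢ Rs).biUnion (fun p => Fintype.piFinset (rows p))).image toSet := by
    intro S hS
    rw [Finset.mem_filter] at hS
    obtain ⟨-, hcard, hcr⟩ := hS
    have hsc := hcr.subset_subcube
    obtain ⟨w, t, hw, hw1, hj⟩ := hcr
    let e : Fin (m + 1) ≃ S := (S.equivFinOfCardEq hcard).symm
    have hsum : ∀ f : (Fin n → Bool) → ℝ, ∑ s ∈ S, f s = ∑ a, f (e a) := by
      intro f
      rw [← Finset.sum_coe_sort S f]
      exact (Equiv.sum_comp e (fun s : S => f s)).symm
    rw [Finset.mem_image]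
    refine ⟨fun j a => (e a : Fin n → Bool) j, ?_, ?_⟩
    · rw [Finset.mem_biUnion]
      refine ⟨⟨Finset.univ.filter (fun r => ∑ a, w (e a) * (if r a then 1 else 0) = t),
        Finset.univ.filter (fun r => ∑ a, w (e a) * (if r a then 1 else 0) = 1 - t)⟩, ?_, ?_⟩
      · rw [Finset.mem_product]
        constructor
        · exact Finset.mem_filter.2 ⟨Finset.mem_univ _,
            card_filter_sum_eq_le _ (fun a => hw _ (e a).2) _⟩
        · exact Finset.mem_filter.2 ⟨Finset.mem_univ _,
            card_filter_sum_eq_le _ (fun a => hw _ (e a).2) _⟩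
      · rw [Fintype.mem_piFinset]
        intro j
        have hjj := hj j
        rw [hsum] at hjj
        simp only [cubePoint] at hjj
        by_cases hxy : x j = y j
        · simp only [rows, hxy, if_true, Finset.mem_singleton]
          funext a
          rw [← hxy]
          exact mem_subcube.1 (hsc (e a).2) j hxy
        · cases hx : x j
          · have hy : y j = true := by
              cases hy : y j
              · exact absurd (hx.trans hy.symm) hxy
              · rfl
            simp only [hx, hy] at hjj
            simp only [rows, hx, hy]
            simpa using hjj
          · have hy : y j = false := by
              cases hy : y j
              · rfl
              · exact absurd (hx.trans hy.symm) hxy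
            simp only [hx, hy] at hjj
            simp only [rows, hx, hy]
            simpa [sub_eq_add_neg] using hjj
    · ext s
      simp only [toSet, Finset.mem_image, Finset.mem_univ, true_and]
      constructor
      · rintro ⟨a, rfl⟩
        exact (e a).2
      · intro hs
        exact ⟨e.symm ⟨s, hs⟩, by simp⟩
  refine (Finset.card_le_card hsub).trans (Finset.card_image_le.trans ?_)
  refine (Finset.card_biUnion_le_card_mul _ _ ((2 ^ m) ^ hammingDist x y) ?_).trans ?_
  · rintro ⟨R, R'⟩ hR
    rw [Finset.mem_product] at hR
    have h1 : R.card ≤ 2 ^ m := (Finset.mem_filter.1 hR.1).2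
    have h2 : R'.card ≤ 2 ^ m := (Finset.mem_filter.1 hR.2).2
    rw [Fintype.card_piFinset, hammingDist, ← Finset.prod_const, Finset.prod_filter]
    refine Finset.prod_le_prod' fun j _ => ?_
    simp only [rows]
    by_cases hxy : x j = y j
    · simp [hxy]
    · cases hx : x j
      · have : y j = true := by
          cases hy : y j
          · exact absurd (hx.trans hy.symm) hxy
          · rfl
        simpa [hx, this] using h1
      · have : y j = false := by
          cases hy : y j
          · rfl
          · exact absurd (hx.trans hy.symm) hxy
        simpa [hx, this] using h2
  · refine Nat.mul_le_mul_right _ ?_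
    rw [Finset.card_product]
    have : Rs.card ≤ 2 ^ 2 ^ (m + 1) := by
      refine (Finset.card_filter_le _ _).trans ?_
      simp
    exact Nat.mul_le_mul this this

/-! ### Half-space traces and the antipodal symmetry of subcubes. -/

lemma card_le_of_forall_shatters_card_le {α : Type*} [Fintype α] [DecidableEq α] [Nonempty α]
    {𝒜 : Finset (Finset α)} {d : ℕ} (h : ∀ s, 𝒜.Shatters s → s.card ≤ d) :
    𝒜.card ≤ (d + 1) * Fintype.card α ^ d := by
  have hv : 𝒜.vcDim ≤ d := Finset.sup_le fun s hs => h s (Finset.mem_shatterer.1 hs)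
  refine 𝒜.card_le_card_shatterer.trans (Finset.card_shatterer_le_sum_vcDim.trans ?_)
  calc ∑ k ∈ Finset.Iic 𝒜.vcDim, (Fintype.card α).choose k
      ≤ ∑ _k ∈ Finset.Iic 𝒜.vcDim, Fintype.card α ^ d := by
        refine Finset.sum_le_sum fun k hk => (Nat.choose_le_pow _ _).trans ?_
        exact Nat.pow_le_pow_right Fintype.card_pos ((Finset.mem_Iic.1 hk).trans hv)
    _ ≤ (d + 1) * Fintype.card α ^ d := by
        rw [Finset.sum_const, Nat.card_Iic, smul_eq_mul]
        exact Nat.mul_le_mul_right _ (by omega)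

/-- The traces on `α` of the open half-spaces through the origin, along `v : α → E`. -/
noncomputable def halfSpaceTraces {α E : Type*} [Fintype α] [AddCommGroup E] [Module ℝ E] (v : α → E) :
    Finset (Finset α) := by
  classical
  exact Finset.univ.filter (fun t => ∃ f : E →ₗ[ℝ] ℝ, ∀ a, a ∈ t ↔ 0 < f (v a))

/-- A shattered set with more elements than the dimension carries a linear relation with some
positive coefficient. A functional positive exactly where the coefficients are positive would make
the relation's value positive, yet it is zero. -/
lemma card_halfSpaceTraces_le {α E : Type*} [Fintype α] [Nonempty α] [AddCommGroup E] [Module ℝ E]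
    [FiniteDimensional ℝ E] (v : α → E) :
    (halfSpaceTraces v).card ≤
      (Module.finrank ℝ E + 1) * Fintype.card α ^ Module.finrank ℝ E := by
  classical
  refine card_le_of_forall_shatters_card_le fun s hs => ?_
  by_contra hlt
  have hdep : ¬ LinearIndependent ℝ (fun a : s => v a) := fun hli => by
    have := hli.fintype_card_le_finrank
    rw [Fintype.card_coe] at this
    omega
  obtain ⟨c, hc, i, hi⟩ : ∃ c : s → ℝ, ∑ a, c a • v a = 0 ∧ ∃ i, 0 < c i := by
    obtain ⟨c, hc, i, hi⟩ := Fintype.not_linearIndependent_iff.1 hdep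
    rcases lt_or_gt_of_ne hi with h | h
    · exact ⟨-c, by simpa [-Finset.univ_eq_attach, Finset.sum_neg_distrib] using hc, i, by simpa using h⟩
    · exact ⟨c, hc, i, h⟩
  obtain ⟨t, ht, hst⟩ := hs (Finset.filter_subset (fun a => ∃ h : a ∈ s, 0 < c ⟨a, h⟩) s)
  simp only [halfSpaceTraces, Finset.mem_filter, Finset.mem_univ, true_and] at ht
  obtain ⟨f, hf⟩ := ht
  have hiff : ∀ a : s, 0 < f (v a) ↔ 0 < c a := by
    intro a
    rw [← hf]
    have := Finset.ext_iff.1 hst a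
    simpa using this
  have hsum : ∑ a, c a * f (v a) = 0 := by
    have := congrArg f hc
    simpa using this
  have hpos : 0 < ∑ a, c a * f (v a) := by
    refine Finset.sum_pos' (fun a _ => ?_) ⟨i, Finset.mem_univ _, mul_pos hi ((hiff i).2 hi)⟩
    by_cases h : 0 < c a
    · exact (mul_pos h ((hiff a).2 h)).le
    · have h' : ¬ 0 < f (v a) := fun h' => h ((hiff a).1 h')
      exact mul_nonneg_of_nonpos_of_nonpos (not_lt.1 h) (not_lt.1 h')
  linarith

lemma two_pow_hammingDist_le {n : ℕ} (x y : Fin n → Bool) (f : (Fin n → ℝ) →ₗ[ℝ] ℝ) :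
    2 ^ hammingDist x y ≤ 2 * ((subcube x y).filter (fun z =>
      ¬ 0 < f ((2 : ℝ) • cubePoint z - cubePoint x - cubePoint y))).card := by
  rw [← card_subcube, ← Finset.card_filter_add_card_filter_not (s := subcube x y) (fun z =>
      0 < f ((2 : ℝ) • cubePoint z - cubePoint x - cubePoint y)), two_mul]
  refine Nat.add_le_add_right ?_ _
  -- Antipodal map of the subcube: it flips exactly the coordinates where `x` and `y` differ, hence
  -- negates `2 z - x - y` there.
  let ρ : (Fin n → Bool) → (Fin n → Bool) := fun z j => xor (xor (x j) (y j)) (z j)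
  have hρ : Function.Injective ρ := by
    intro z z' h
    funext j
    have := congrFun h j
    simp only [ρ] at this
    cases hz : z j <;> cases hz' : z' j <;> simp_all
  refine Finset.card_le_card_of_injOn ρ ?_ hρ.injOn
  intro z hz
  rw [Finset.mem_coe, Finset.mem_filter] at hz ⊢
  have hz' := mem_subcube.1 hz.1
  refine ⟨mem_subcube.2 fun j hj => ?_, ?_⟩
  · have := hz' j hj
    simp [ρ, hj, this]
  · have : (2 : ℝ) • cubePoint (ρ z) - cubePoint x - cubePoint y
        = -((2 : ℝ) • cubePoint z - cubePoint x - cubePoint y) := by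
      funext j
      have := hz' j
      have key : ∀ a b c : Bool, (a = b → c = a) →
          (2 : ℝ) * (if xor (xor a b) c then 1 else 0) - (if a then 1 else 0) - (if b then 1 else 0)
            = -(2 * (if c then 1 else 0) - (if a then 1 else 0) - (if b then 1 else 0)) := by
        intro a b c
        cases a <;> cases b <;> cases c <;> norm_num
      exact key _ _ _ this
    rw [this, map_neg]
    linarith [hz.2]

lemma card_filter_hammingDist_eq {n : ℕ} (x : Fin n → Bool) (d : ℕ) :
    (Finset.univ.filter (fun y => hammingDist x y = d)).card = n.choose d := by
  rw [show n.choose d = ((Finset.univ : Finset (Fin n)).powersetCard d).card by simp]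
  refine Finset.card_bij' (fun y _ => Finset.univ.filter (fun j => x j ≠ y j))
    (fun s _ j => xor (x j) (decide (j ∈ s))) ?_ ?_ ?_ ?_
  · intro y hy
    rw [Finset.mem_powersetCard]
    exact ⟨Finset.subset_univ _, (Finset.mem_filter.1 hy).2⟩
  · intro s hs
    rw [Finset.mem_filter]
    refine ⟨Finset.mem_univ _, ?_⟩
    rw [← (Finset.mem_powersetCard.1 hs).2, hammingDist]
    congr 1
    ext j
    cases hx : x j <;> simp [hx]
  · intro y _
    funext j
    cases hx : x j <;> cases hy : y j <;> simp [hx, hy]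
  · intro s _
    ext j
    cases hx : x j <;> simp [hx]

/-! ### First-moment bounds for non-edges. -/

lemma measureReal_exists_mem_le {Ω ι : Type*} [MeasurableSpace Ω] (μ : Measure Ω)
    [IsFiniteMeasure μ] (I : Finset ι) (P : ι → Ω → Prop) :
    μ.real {ω | ∃ i ∈ I, P i ω} ≤ ∑ i ∈ I, μ.real {ω | P i ω} := by
  have : {ω | ∃ i ∈ I, P i ω} = ⋃ i ∈ I, {ω | P i ω} := by
    ext ω
    simp
  rw [this]
  exact measureReal_biUnion_finset_le I _

section Cube
variable {n : ℕ} (p : unitInterval)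

instance : IsProbabilityMeasure (randomCubeSubset n p) := by
  unfold randomCubeSubset
  infer_instance

lemma randomCubeSubset_real_superset (S : Finset (Fin n → Bool)) :
    (randomCubeSubset n p).real {Q | (S : Set (Fin n → Bool)) ⊆ Q} = (p : ℝ) ^ S.card :=
  setBernoulli_univ_real_superset p S

lemma randomCubeSubset_real_disjoint (S : Finset (Fin n → Bool)) :
    (randomCubeSubset n p).real {Q | ∀ x ∈ S, x ∉ Q} = (1 - (p : ℝ)) ^ S.card :=
  setBernoulli_univ_real_disjoint p S

/-- The sum factors over coordinates. It serves with `θ = 2` for counting close pairs and with `θ =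
δ / (1 - δ)` for the Chernoff bound. -/
lemma sum_pow_hammingDist (x : Fin n → Bool) (θ : ℝ) :
    ∑ y, θ ^ hammingDist x y = (1 + θ) ^ n := by
  have h : ∀ y, θ ^ hammingDist x y = ∏ j, if x j = y j then 1 else θ := by
    intro y
    rw [hammingDist, ← Finset.prod_const, Finset.prod_filter]
    refine Finset.prod_congr rfl fun j _ => ?_
    by_cases hj : x j = y j <;> simp [hj]
  simp_rw [h]
  rw [← Fintype.piFinset_univ, ← Finset.prod_univ_sum (fun _ => Finset.univ)
    (fun j b => if x j = b then (1 : ℝ) else θ)]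
  have : ∀ j, ∑ b, (if x j = b then (1 : ℝ) else θ) = 1 + θ := by
    intro j
    cases x j <;> simp [add_comm]
  rw [Finset.prod_congr rfl fun j _ => this j]
  simp

lemma prob_exists_far_pair_le (D : ℝ) (N : ℝ)
    (hN : ∀ x : Fin n → Bool, ((Finset.univ.filter (fun y => D ≤ hammingDist x y)).card : ℝ) ≤ N) :
    (randomCubeSubset n p).real {Q | ∃ x ∈ Q, ∃ y ∈ Q, x ≠ y ∧ D ≤ hammingDist x y}
      ≤ 2 ^ n * N * (p : ℝ) ^ 2 := by
  have hsub : {Q : Set (Fin n → Bool) | ∃ x ∈ Q, ∃ y ∈ Q, x ≠ y ∧ D ≤ hammingDist x y} ⊆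
      {Q | ∃ x ∈ (Finset.univ : Finset (Fin n → Bool)),
        ∃ y ∈ Finset.univ.filter (fun y => x ≠ y ∧ D ≤ hammingDist x y),
        ((({x, y} : Finset (Fin n → Bool))) : Set (Fin n → Bool)) ⊆ Q} := by
    rintro Q ⟨x, hx, y, hy, hxy, hd⟩
    refine ⟨x, Finset.mem_univ _, y, by simp [hxy, hd], ?_⟩
    simp [Set.insert_subset_iff, hx, hy]
  refine (measureReal_mono hsub).trans ((measureReal_exists_mem_le _ _ _).trans ?_)
  have h1 : ∀ x ∈ (Finset.univ : Finset (Fin n → Bool)), (randomCubeSubset n p).real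
      {Q | ∃ y ∈ Finset.univ.filter (fun y => x ≠ y ∧ D ≤ hammingDist x y),
        ((({x, y} : Finset (Fin n → Bool))) : Set (Fin n → Bool)) ⊆ Q} ≤ N * (p : ℝ) ^ 2 := by
    intro x _
    refine (measureReal_exists_mem_le _ _ _).trans ?_
    rw [Finset.sum_congr rfl (g := fun _ => (p : ℝ) ^ 2), Finset.sum_const, nsmul_eq_mul]
    · refine mul_le_mul_of_nonneg_right (le_trans ?_ (hN x)) (by positivity)
      refine Nat.cast_le.2 (Finset.card_le_card fun y hy => ?_)
      exact Finset.mem_filter.2 ⟨Finset.mem_univ _, (Finset.mem_filter.1 hy).2.2⟩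
    · intro y hy
      rw [randomCubeSubset_real_superset, Finset.card_pair (Finset.mem_filter.1 hy).2.1]
  refine (Finset.sum_le_sum h1).trans (le_of_eq ?_)
  simp [mul_assoc]

lemma prob_exists_dense_subcube_le (D : ℝ) (k : ℕ) (q : ℝ) (hq0 : 0 ≤ q)
    (hq : ∀ d : ℕ, (d : ℝ) < D → 2 ^ d * (p : ℝ) ≤ q) :
    (randomCubeSubset n p).real {Q | ∃ x y : Fin n → Bool, (hammingDist x y : ℝ) < D ∧
      ∃ S : Finset (Fin n → Bool), S ⊆ subcube x y ∧ S.card = k ∧ ↑S ⊆ Q} ≤ 4 ^ n * q ^ k := by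
  have hp0 : (0 : ℝ) ≤ p := p.2.1
  have hsub : {Q : Set (Fin n → Bool) | ∃ x y : Fin n → Bool, (hammingDist x y : ℝ) < D ∧
      ∃ S : Finset (Fin n → Bool), S ⊆ subcube x y ∧ S.card = k ∧ ↑S ⊆ Q} ⊆
      {Q | ∃ e ∈ Finset.univ.filter
          (fun e : (Fin n → Bool) × (Fin n → Bool) => (hammingDist e.1 e.2 : ℝ) < D),
        ∃ S ∈ (subcube e.1 e.2).powersetCard k, (S : Set (Fin n → Bool)) ⊆ Q} := by
    rintro Q ⟨x, y, hd, S, hS, hk, hSQ⟩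
    exact ⟨(x, y), by simpa using hd, S, Finset.mem_powersetCard.2 ⟨hS, hk⟩, hSQ⟩
  refine (measureReal_mono hsub).trans ((measureReal_exists_mem_le _ _ _).trans ?_)
  have h1 : ∀ e ∈ Finset.univ.filter
      (fun e : (Fin n → Bool) × (Fin n → Bool) => (hammingDist e.1 e.2 : ℝ) < D),
      (randomCubeSubset n p).real
        {Q | ∃ S ∈ (subcube e.1 e.2).powersetCard k, (S : Set (Fin n → Bool)) ⊆ Q} ≤ q ^ k := by
    intro e he
    refine (measureReal_exists_mem_le _ _ _).trans ?_
    rw [Finset.sum_congr rfl (g := fun _ => (p : ℝ) ^ k), Finset.sum_const, nsmul_eq_mul,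
      Finset.card_powersetCard, card_subcube]
    · refine le_trans ?_ (pow_le_pow_left₀ (by positivity) (hq _ (Finset.mem_filter.1 he).2) k)
      rw [mul_pow]
      refine mul_le_mul_of_nonneg_right ?_ (by positivity)
      exact_mod_cast Nat.choose_le_pow _ _
    · intro S hS
      rw [randomCubeSubset_real_superset, (Finset.mem_powersetCard.1 hS).2]
  refine (Finset.sum_le_sum h1).trans ?_
  rw [Finset.sum_const, nsmul_eq_mul]
  refine mul_le_mul_of_nonneg_right ?_ (by positivity)
  refine (Nat.cast_le.2 (Finset.card_filter_le _ _)).trans (le_of_eq ?_)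
  simp [← mul_pow]

lemma prob_exists_crossesLine_le (D : ℝ) (k : ℕ)
    (hp : ∀ d : ℕ, (d : ℝ) < D → 2 ^ d * (p : ℝ) ≤ 1) :
    (randomCubeSubset n p).real {Q | ∃ x ∈ Q, ∃ y ∈ Q, x ≠ y ∧ (hammingDist x y : ℝ) < D ∧
      ∃ S : Finset (Fin n → Bool), ↑S ⊆ Q ∧ x ∉ S ∧ y ∉ S ∧ CrossesLine x y S ∧ S.card < k}
      ≤ (∑ m ∈ Finset.range k, (2 ^ 2 ^ (m + 1) * 2 ^ 2 ^ (m + 1) : ℝ)) * (6 ^ n * (p : ℝ) ^ 4) := by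
  classical
  have hp0 : (0 : ℝ) ≤ p := p.2.1
  let F : (Fin n → Bool) × (Fin n → Bool) → ℕ → Finset (Finset (Fin n → Bool)) := fun e m =>
    Finset.univ.filter (fun S => (S.card = m + 1 ∧ CrossesLine e.1 e.2 S) ∧ e.1 ∉ S ∧ e.2 ∉ S)
  let E : Finset ((Fin n → Bool) × (Fin n → Bool)) :=
    Finset.univ.filter (fun e => e.1 ≠ e.2 ∧ (hammingDist e.1 e.2 : ℝ) < D)
  have hsub : {Q : Set (Fin n → Bool) | ∃ x ∈ Q, ∃ y ∈ Q, x ≠ y ∧ (hammingDist x y : ℝ) < D ∧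
      ∃ S : Finset (Fin n → Bool), ↑S ⊆ Q ∧ x ∉ S ∧ y ∉ S ∧ CrossesLine x y S ∧ S.card < k} ⊆
      {Q | ∃ e ∈ E, ∃ m ∈ Finset.Ico 1 k, ∃ S ∈ F e m,
        ((insert e.1 (insert e.2 S) : Finset (Fin n → Bool)) : Set (Fin n → Bool)) ⊆ Q} := by
    rintro Q ⟨x, hx, y, hy, hxy, hd, S, hSQ, hxS, hyS, hcr, hk⟩
    have h2 := hcr.two_le_card hxy hxS hyS
    refine ⟨(x, y), by simpa [E] using ⟨hxy, hd⟩, S.card - 1, ?_, S, ?_, ?_⟩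
    · rw [Finset.mem_Ico]
      omega
    · exact Finset.mem_filter.2 ⟨Finset.mem_univ _, ⟨by omega, hcr⟩, hxS, hyS⟩
    · simpa [Set.insert_subset_iff, hx, hy] using hSQ
  have hF : ∀ e ∈ E, ∀ m ∈ Finset.Ico 1 k, (randomCubeSubset n p).real {Q | ∃ S ∈ F e m,
        ((insert e.1 (insert e.2 S) : Finset (Fin n → Bool)) : Set (Fin n → Bool)) ⊆ Q} ≤
      (2 ^ 2 ^ (m + 1) * 2 ^ 2 ^ (m + 1)) * (2 ^ hammingDist e.1 e.2 * (p : ℝ) ^ 4) := by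
    intro e he m hm
    obtain ⟨-, hne, hd⟩ := Finset.mem_filter.1 he
    refine (measureReal_exists_mem_le _ _ _).trans ?_
    -- The `m + 1` points of `S`, together with `x` and `y` outside it.
    rw [Finset.sum_congr rfl (g := fun _ => (p : ℝ) ^ (m + 3)), Finset.sum_const, nsmul_eq_mul]
    · have hcard : ((F e m).card : ℝ) ≤
          (2 ^ 2 ^ (m + 1)) * (2 ^ 2 ^ (m + 1)) * (2 ^ m) ^ hammingDist e.1 e.2 := by
        have h1 : (F e m).card ≤ _ := (Finset.card_le_card (fun S hS =>
          Finset.mem_filter.2 ⟨Finset.mem_univ _, (Finset.mem_filter.1 hS).2.1⟩)).trans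
            (card_filter_crossesLine_le e.1 e.2 m)
        exact_mod_cast h1
      refine (mul_le_mul_of_nonneg_right hcard (by positivity)).trans ?_
      rw [mul_assoc]
      refine mul_le_mul_of_nonneg_left ?_ (by positivity)
      -- `m ≥ 1` comes from `CrossesLine.two_le_card`; it leaves `m - 1` spare factors `2 ^ d * p ≤
      -- 1` to discard, so only `2 ^ d * p ^ 4` remains.
      obtain ⟨l, rfl⟩ : ∃ l, m = l + 1 := ⟨m - 1, by have := (Finset.mem_Ico.1 hm).1; omega⟩
      have hle : (2 ^ hammingDist e.1 e.2 * (p : ℝ)) ^ l ≤ 1 :=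
        pow_le_one₀ (by positivity) (hp _ hd)
      calc ((2 : ℝ) ^ (l + 1)) ^ hammingDist e.1 e.2 * (p : ℝ) ^ (l + 1 + 3)
          = (2 ^ hammingDist e.1 e.2 * (p : ℝ)) ^ l * (2 ^ hammingDist e.1 e.2 * (p : ℝ) ^ 4) := by
            rw [← pow_mul, mul_comm (l + 1), pow_mul]
            ring
        _ ≤ _ := mul_le_of_le_one_left (by positivity) hle
    · intro S hS
      obtain ⟨-, ⟨hcard, -⟩, h1, h2⟩ := Finset.mem_filter.1 hS
      rw [randomCubeSubset_real_superset, Finset.card_insert_of_notMem (by simp [hne, h1]),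
        Finset.card_insert_of_notMem h2, hcard]
  have hE : ∀ e ∈ E, (randomCubeSubset n p).real {Q | ∃ m ∈ Finset.Ico 1 k, ∃ S ∈ F e m,
        ((insert e.1 (insert e.2 S) : Finset (Fin n → Bool)) : Set (Fin n → Bool)) ⊆ Q} ≤
      (∑ m ∈ Finset.range k, (2 ^ 2 ^ (m + 1) * 2 ^ 2 ^ (m + 1) : ℝ)) *
        (2 ^ hammingDist e.1 e.2 * (p : ℝ) ^ 4) := by
    intro e he
    refine (measureReal_exists_mem_le _ _ _).trans ((Finset.sum_le_sum (hF e he)).trans ?_)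
    rw [← Finset.sum_mul]
    refine mul_le_mul_of_nonneg_right ?_ (by positivity)
    refine Finset.sum_le_sum_of_subset_of_nonneg (fun m hm => ?_) (fun _ _ _ => by positivity)
    exact Finset.mem_range.2 (Finset.mem_Ico.1 hm).2
  refine (measureReal_mono hsub).trans ((measureReal_exists_mem_le _ _ _).trans
    ((Finset.sum_le_sum hE).trans ?_))
  rw [← Finset.mul_sum]
  refine mul_le_mul_of_nonneg_left ?_ (by positivity)
  calc ∑ e ∈ E, (2 : ℝ) ^ hammingDist e.1 e.2 * (p : ℝ) ^ 4
      ≤ ∑ e : (Fin n → Bool) × (Fin n → Bool), (2 : ℝ) ^ hammingDist e.1 e.2 * (p : ℝ) ^ 4 :=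
        Finset.sum_le_sum_of_subset_of_nonneg (Finset.subset_univ _) (fun _ _ _ => by positivity)
    _ = 6 ^ n * (p : ℝ) ^ 4 := by
        rw [← Finset.sum_mul, Fintype.sum_prod_type]
        simp_rw [sum_pow_hammingDist]
        simp [← mul_pow]
        norm_num

lemma prob_not_clique_le (D : ℝ) (k : ℕ) (N q : ℝ)
    (hN : ∀ x : Fin n → Bool, ((Finset.univ.filter (fun y => D ≤ hammingDist x y)).card : ℝ) ≤ N)
    (hq0 : 0 ≤ q) (hq1 : q ≤ 1) (hq : ∀ d : ℕ, (d : ℝ) < D → 2 ^ d * (p : ℝ) ≤ q) :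
    (randomCubeSubset n p).real {Q | polytopeGraph (zeroOnePolytope Q) ≠ ⊤} ≤
      2 ^ n * N * (p : ℝ) ^ 2 + 4 ^ n * q ^ k +
      (∑ m ∈ Finset.range k, (2 ^ 2 ^ (m + 1) * 2 ^ 2 ^ (m + 1) : ℝ)) * (6 ^ n * (p : ℝ) ^ 4) := by
  have h1 := prob_exists_far_pair_le (n := n) p D N hN
  have h2 := prob_exists_dense_subcube_le (n := n) p D k q hq0 hq
  have h3 := prob_exists_crossesLine_le (n := n) p D k (fun d hd => (hq d hd).trans hq1)
  refine le_trans ?_ (add_le_add (add_le_add h1 h2) h3)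
  refine le_trans (measureReal_mono ?_) ((measureReal_union_le _ _).trans
    (add_le_add_left (measureReal_union_le _ _) _))
  intro Q hQ
  simp only [Set.mem_ofPred_eq, ne_eq, polytopeGraph_eq_top_iff] at hQ
  push Not at hQ
  obtain ⟨x, hx, y, hy, hxy, hface⟩ := hQ
  obtain ⟨S, hSQ, hxS, hyS, hcr⟩ := exists_crossesLine_of_not_isFace hx hy hface
  rcases le_or_gt D (hammingDist x y) with hd | hd
  · exact Or.inl (Or.inl ⟨x, hx, y, hy, hxy, hd⟩)
  · rcases lt_or_ge S.card k with hk | hk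
    · exact Or.inr ⟨x, hx, y, hy, hxy, hd, S, hSQ, hxS, hyS, hcr, hk⟩
    · obtain ⟨S', hS', hk'⟩ := Finset.exists_subset_card_eq hk
      exact Or.inl (Or.inr ⟨x, y, hd, S', hS'.trans hcr.subset_subcube, hk',
        (Finset.coe_subset.2 hS').trans hSQ⟩)

end Cube

/-! ### The second moment method and the missed half-spaces. -/

/-- Chebyshev's argument: when the count `X` vanishes, `(X - m) ^ 2 = m ^ 2`, so the right side is
the variance of `X`. -/
lemma sq_mul_measureReal_eq_zero_le {Ω ι : Type*} [MeasurableSpace Ω] [DiscreteMeasurableSpace Ω]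
    [Finite Ω] (μ : Measure Ω) [IsProbabilityMeasure μ] (I : Finset ι) (A : ι → Set Ω) :
    (∑ i ∈ I, μ.real (A i)) ^ 2 * μ.real {ω | ∀ i ∈ I, ω ∉ A i} ≤
      ∑ i ∈ I, ∑ j ∈ I, μ.real (A i ∩ A j) - (∑ i ∈ I, μ.real (A i)) ^ 2 := by
  classical
  set m := ∑ i ∈ I, μ.real (A i) with hm
  let X : Ω → ℝ := fun ω => ∑ i ∈ I, (A i).indicator 1 ω
  have hms : ∀ s : Set Ω, MeasurableSet s := fun s => .of_discrete
  have hint : ∀ f : Ω → ℝ, Integrable f μ := fun f => .of_finite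
  have hX : ∫ ω, X ω ∂μ = m := by
    rw [integral_finsetSum _ fun i _ => hint _]
    exact Finset.sum_congr rfl fun i _ => integral_indicator_one (hms _)
  have hX2 : ∫ ω, X ω ^ 2 ∂μ = ∑ i ∈ I, ∑ j ∈ I, μ.real (A i ∩ A j) := by
    have : ∀ ω, X ω ^ 2 = ∑ i ∈ I, ∑ j ∈ I, (A i ∩ A j).indicator 1 ω := by
      intro ω
      simp only [X, sq, Finset.sum_mul_sum, Set.inter_indicator_one, Pi.mul_apply]
    simp_rw [this]
    rw [integral_finsetSum _ fun i _ => hint _]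
    refine Finset.sum_congr rfl fun i _ => ?_
    rw [integral_finsetSum _ fun i _ => hint _]
    exact Finset.sum_congr rfl fun j _ => integral_indicator_one (hms _)
  have hvar : ∫ ω, (X ω - m) ^ 2 ∂μ = ∑ i ∈ I, ∑ j ∈ I, μ.real (A i ∩ A j) - m ^ 2 := by
    have : ∀ ω, (X ω - m) ^ 2 = X ω ^ 2 - (2 * m * X ω - m ^ 2) := fun ω => by ring
    simp_rw [this]
    rw [integral_sub (hint _) (hint _), integral_sub (hint _) (hint _), integral_const_mul, hX, hX2]
    simp
    ring
  rw [← hvar, ← integral_indicator_one (hms _), ← integral_const_mul]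
  refine integral_mono (hint _) (hint _) fun ω => ?_
  by_cases h : ω ∈ {ω | ∀ i ∈ I, ω ∉ A i}
  · have : X ω = 0 := Finset.sum_eq_zero fun i hi => by simp [h i hi]
    simp [h, this]
  · simp only [Set.indicator_of_notMem h, mul_zero]
    positivity

section Cube
variable {n : ℕ} (p : unitInterval)

/-- The ordered pairs of points of the cube at Hamming distance `d`. -/
def pairsAtDist (n d : ℕ) : Finset ((Fin n → Bool) × (Fin n → Bool)) :=
  Finset.univ.filter (fun e => hammingDist e.1 e.2 = d)

lemma mem_pairsAtDist {d : ℕ} {e : (Fin n → Bool) × (Fin n → Bool)} :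
    e ∈ pairsAtDist n d ↔ hammingDist e.1 e.2 = d := by
  simp [pairsAtDist]

lemma sum_pairsAtDist (d : ℕ) (f : (Fin n → Bool) × (Fin n → Bool) → ℝ) :
    ∑ e ∈ pairsAtDist n d, f e =
      ∑ x, ∑ y ∈ Finset.univ.filter (fun y => hammingDist x y = d), f (x, y) := by
  rw [pairsAtDist, Finset.sum_filter, Fintype.sum_prod_type]
  simp_rw [Finset.sum_filter]

lemma sum_pairsAtDist_ite_fst (d : ℕ) (a : Fin n → Bool) :
    ∑ e ∈ pairsAtDist n d, (if e.1 = a then (1 : ℝ) else 0) = n.choose d := by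
  rw [sum_pairsAtDist]
  have h : ∀ x : Fin n → Bool, ∑ _y ∈ Finset.univ.filter (fun y => hammingDist x y = d),
      (if x = a then (1 : ℝ) else 0) = if x = a then (n.choose d : ℝ) else 0 := fun x => by
    rw [Finset.sum_const, card_filter_hammingDist_eq]
    simp
  simp [h]

lemma sum_pairsAtDist_ite_snd (d : ℕ) (a : Fin n → Bool) :
    ∑ e ∈ pairsAtDist n d, (if e.2 = a then (1 : ℝ) else 0) = n.choose d := by
  rw [← sum_pairsAtDist_ite_fst d a]
  refine Finset.sum_nbij' (fun e => e.swap) (fun e => e.swap) ?_ ?_ ?_ ?_ ?_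
  · intro e he
    rw [mem_pairsAtDist] at he ⊢
    rw [← he]
    exact hammingDist_comm _ _
  · intro e he
    rw [mem_pairsAtDist] at he ⊢
    rw [← he]
    exact hammingDist_comm _ _
  all_goals simp

lemma card_pairsAtDist (d : ℕ) : ((pairsAtDist n d).card : ℝ) = 2 ^ n * n.choose d := by
  have := sum_pairsAtDist (n := n) d (fun _ => 1)
  simp only [Finset.sum_const, card_filter_hammingDist_eq, nsmul_eq_mul, mul_one] at this
  rw [this]
  simp

/-- The union has 4, 3 or 2 elements; the indicators list the four ways to share a point and the two
ways to coincide. -/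
lemma pow_card_union_pair_le {α : Type*} [DecidableEq α] {q : ℝ} (hq0 : 0 ≤ q) (hq1 : q ≤ 1)
    {x y x' y' : α} (hxy : x ≠ y) (hxy' : x' ≠ y') :
    q ^ (({x, y} ∪ {x', y'} : Finset α)).card ≤ q ^ 4 + q ^ 3 * ((if x' = x then 1 else 0) +
      (if x' = y then 1 else 0) + (if y' = x then 1 else 0) + (if y' = y then 1 else 0)) +
      q ^ 2 * ((if (x', y') = (x, y) then 1 else 0) + (if (x', y') = (y, x) then 1 else 0)) := by
  have h2 : 0 ≤ q ^ 2 := by positivity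
  have h3 : 0 ≤ q ^ 3 := by positivity
  have h4 : 0 ≤ q ^ 4 := by positivity
  have hc2 : (({x, y} : Finset α)).card = 2 := Finset.card_pair hxy
  have hle : 2 ≤ (({x, y} ∪ {x', y'} : Finset α)).card := by
    rw [← hc2]
    exact Finset.card_le_card Finset.subset_union_left
  have hp2 : q ^ (({x, y} ∪ {x', y'} : Finset α)).card ≤ q ^ 2 := pow_le_pow_of_le_one hq0 hq1 hle
  by_cases h1 : x' = x
  · by_cases h1' : y' = y
    · simp only [h1, h1', if_true] at hp2 ⊢
      split_ifs <;> nlinarith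
    · have : (({x, y} ∪ {x', y'} : Finset α)).card = 3 := by
        have : ({x, y} ∪ {x', y'} : Finset α) = {x, y, y'} := by
          ext z
          simp [h1]
        rw [this, Finset.card_eq_three]
        exact ⟨x, y, y', hxy, h1 ▸ hxy', fun h => h1' h.symm, rfl⟩
      rw [this]
      split_ifs <;> simp_all
  · by_cases h5 : x' = y
    · by_cases h6 : y' = x
      · subst h5 h6
        simp only [if_true] at hp2 ⊢
        split_ifs <;> nlinarith
      · have : (({x, y} ∪ {x', y'} : Finset α)).card = 3 := by
          have : ({x, y} ∪ {x', y'} : Finset α) = {x, y, y'} := by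
            ext z
            simp [h5]
          rw [this, Finset.card_eq_three]
          exact ⟨x, y, y', hxy, fun h => h6 h.symm, h5 ▸ hxy', rfl⟩
        rw [this]
        split_ifs <;> simp_all
    · have h3le : 3 ≤ (({x, y} ∪ {x', y'} : Finset α)).card := by
        have : ({x, y, x'} : Finset α).card = 3 := by
          rw [Finset.card_eq_three]
          exact ⟨x, y, x', hxy, fun h => h1 h.symm, fun h => h5 h.symm, rfl⟩
        rw [← this]
        refine Finset.card_le_card fun z hz => ?_
        simp at hz ⊢
        tauto
      have hp3 : q ^ (({x, y} ∪ {x', y'} : Finset α)).card ≤ q ^ 3 :=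
        pow_le_pow_of_le_one hq0 hq1 h3le
      by_cases h7 : y' = x
      · split_ifs <;> simp_all <;> nlinarith
      · by_cases h8 : y' = y
        · split_ifs <;> simp_all
        · have : (({x, y} ∪ {x', y'} : Finset α)).card = 4 := by
            rw [Finset.card_union_of_disjoint, hc2, Finset.card_pair hxy']
            simp
            tauto
          rw [this]
          split_ifs <;> simp_all

/-- In the variance, the `q ^ 4` terms cancel the squared mean. Pairs sharing one point give the
first summand and coinciding pairs the second, after division by `(2 ^ n * C * q ^ 2) ^ 2`. -/
lemma prob_no_pair_at_dist_le {d : ℕ} (hd : 1 ≤ d) (hdn : d ≤ n) (hp : 0 < (p : ℝ)) :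
    (randomCubeSubset n p).real {Q | ∀ x ∈ Q, ∀ y ∈ Q, hammingDist x y ≠ d} ≤
      4 / (2 ^ n * p) + 2 / (2 ^ n * n.choose d * (p : ℝ) ^ 2) := by
  classical
  set q : ℝ := (p : ℝ) with hq
  have hq1 : q ≤ 1 := p.2.2
  set C : ℝ := (n.choose d : ℝ) with hC
  have hC0 : 0 < C := by
    rw [hC]
    exact_mod_cast Nat.choose_pos hdn
  let A : (Fin n → Bool) × (Fin n → Bool) → Set (Set (Fin n → Bool)) := fun e =>
    {Q | ((({e.1, e.2} : Finset (Fin n → Bool))) : Set (Fin n → Bool)) ⊆ Q}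
  have hne : ∀ e ∈ pairsAtDist n d, e.1 ≠ e.2 := by
    intro e he h
    rw [mem_pairsAtDist, h, hammingDist_self] at he
    omega
  have hA : ∀ e ∈ pairsAtDist n d, (randomCubeSubset n p).real (A e) = q ^ 2 := by
    intro e he
    rw [randomCubeSubset_real_superset, Finset.card_pair (hne e he)]
  have hAA : ∀ e ∈ pairsAtDist n d, ∑ f ∈ pairsAtDist n d, (randomCubeSubset n p).real (A e ∩ A f)
      ≤ 2 ^ n * C * q ^ 4 + (4 * C * q ^ 3 + 2 * q ^ 2) := by
    rintro ⟨x, y⟩ he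
    have hle : ∀ f ∈ pairsAtDist n d, (randomCubeSubset n p).real (A (x, y) ∩ A f) ≤
        q ^ 4 + q ^ 3 * ((if f.1 = x then 1 else 0) + (if f.1 = y then 1 else 0) +
        (if f.2 = x then 1 else 0) + (if f.2 = y then 1 else 0)) +
        q ^ 2 * ((if f = (x, y) then 1 else 0) + (if f = (y, x) then 1 else 0)) := by
      rintro ⟨x', y'⟩ hf
      have hinter : A (x, y) ∩ A (x', y') =
          {Q | ((({x, y} ∪ {x', y'} : Finset (Fin n → Bool))) : Set (Fin n → Bool)) ⊆ Q} := by
        ext Q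
        simp only [A, Set.mem_inter_iff, Set.mem_ofPred_eq, Finset.coe_union, Set.union_subset_iff]
      rw [hinter, randomCubeSubset_real_superset]
      exact pow_card_union_pair_le hp.le hq1 (hne _ he) (hne _ hf)
    refine (Finset.sum_le_sum hle).trans ?_
    rw [Finset.sum_add_distrib, Finset.sum_add_distrib, ← Finset.mul_sum, ← Finset.mul_sum,
      Finset.sum_add_distrib, Finset.sum_add_distrib, Finset.sum_add_distrib,
      Finset.sum_add_distrib, sum_pairsAtDist_ite_fst, sum_pairsAtDist_ite_fst,
      sum_pairsAtDist_ite_snd, sum_pairsAtDist_ite_snd, Finset.sum_const, nsmul_eq_mul,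
      card_pairsAtDist]
    have h1 : ∀ a, ∑ f ∈ pairsAtDist n d, (if f = a then (1 : ℝ) else 0) ≤ 1 := by
      intro a
      rw [Finset.sum_ite_eq' (pairsAtDist n d) a]
      split_ifs <;> norm_num
    have := mul_le_mul_of_nonneg_left (add_le_add (h1 (x, y)) (h1 (y, x)))
      (by positivity : (0 : ℝ) ≤ q ^ 2)
    linarith
  have hmain := sq_mul_measureReal_eq_zero_le (randomCubeSubset n p) (pairsAtDist n d) A
  rw [Finset.sum_congr rfl hA, Finset.sum_const, nsmul_eq_mul, card_pairsAtDist] at hmain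
  have hsum := Finset.sum_le_sum hAA
  rw [Finset.sum_const, nsmul_eq_mul, card_pairsAtDist] at hsum
  have hset : {Q : Set (Fin n → Bool) | ∀ e ∈ pairsAtDist n d, Q ∉ A e} =
      {Q | ∀ x ∈ Q, ∀ y ∈ Q, hammingDist x y ≠ d} := by
    ext Q
    simp only [A, Set.mem_ofPred_eq, mem_pairsAtDist, Prod.forall, Finset.coe_insert,
      Finset.coe_singleton, Set.insert_subset_iff, Set.singleton_subset_iff]
    constructor
    · intro h x hx y hy hxy
      exact h x y hxy ⟨hx, hy⟩
    · rintro h x y hxy ⟨hx, hy⟩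
      exact h x hx y hy hxy
  rw [hset, ← hC] at hmain
  have hpos : 0 < (2 ^ n * C * q ^ 2) ^ 2 := by positivity
  rw [← mul_le_mul_iff_right₀ hpos]
  refine hmain.trans ((sub_le_sub_right hsum _).trans (le_of_eq ?_))
  rw [← hC]
  field_simp
  ring

/-- Union bound over pairs and half-space traces. The complement of a trace holds at least `2 ^ (d -
1)` points of the subcube; the `- 2` accounts for `x` and `y`, which do belong to `Q`. -/
lemma prob_missed_crossing_le (d : ℕ) :
    (randomCubeSubset n p).real {Q | ∃ x ∈ Q, ∃ y ∈ Q, hammingDist x y = d ∧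
      IsFace (zeroOnePolytope Q) (segment ℝ (cubePoint x) (cubePoint y))} ≤
      4 ^ n * ((n + 1) * (2 ^ n) ^ n) * (1 - (p : ℝ)) ^ (2 ^ (d - 1) - 2) := by
  classical
  have hp0 : 0 ≤ 1 - (p : ℝ) := by linarith [p.2.2]
  have hp1 : 1 - (p : ℝ) ≤ 1 := by linarith [p.2.1]
  let v : (Fin n → Bool) × (Fin n → Bool) → (Fin n → Bool) → Fin n → ℝ := fun e z =>
    (2 : ℝ) • cubePoint z - cubePoint e.1 - cubePoint e.2
  let B : (Fin n → Bool) × (Fin n → Bool) → Finset (Fin n → Bool) → Finset (Fin n → Bool) :=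
    fun e t => (subcube e.1 e.2).filter (fun z => z ∉ t) \ {e.1, e.2}
  have hsub : {Q : Set (Fin n → Bool) | ∃ x ∈ Q, ∃ y ∈ Q, hammingDist x y = d ∧
      IsFace (zeroOnePolytope Q) (segment ℝ (cubePoint x) (cubePoint y))} ⊆
      {Q | ∃ e ∈ pairsAtDist n d, ∃ t ∈ halfSpaceTraces (v e), ∀ z ∈ B e t, z ∉ Q} := by
    rintro Q ⟨x, hx, y, hy, hd, hface⟩
    obtain ⟨g, hg⟩ := exists_halfSpace_of_isFace_segment hface
    refine ⟨(x, y), mem_pairsAtDist.2 hd, Finset.univ.filter (fun z => 0 < g (v (x, y) z)), ?_, ?_⟩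
    · simp only [halfSpaceTraces, Finset.mem_filter, Finset.mem_univ, true_and]
      exact ⟨g.toLinearMap, fun a => Iff.rfl⟩
    · intro z hz hzQ
      simp only [B, Finset.mem_sdiff, Finset.mem_filter, Finset.mem_univ, true_and,
        Finset.mem_insert, Finset.mem_singleton, not_or] at hz
      have := hg z hzQ hz.2.1 hz.2.2
      apply hz.1.2
      simp only [v, map_sub, map_smul, smul_eq_mul]
      linarith
  have ht : ∀ e ∈ pairsAtDist n d, ∀ t ∈ halfSpaceTraces (v e),
      (randomCubeSubset n p).real {Q | ∀ z ∈ B e t, z ∉ Q} ≤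
        (1 - (p : ℝ)) ^ (2 ^ (d - 1) - 2) := by
    intro e he t ht
    rw [randomCubeSubset_real_disjoint]
    refine pow_le_pow_of_le_one hp0 hp1 ?_
    simp only [halfSpaceTraces, Finset.mem_filter, Finset.mem_univ, true_and] at ht
    obtain ⟨f, hf⟩ := ht
    have h1 := two_pow_hammingDist_le e.1 e.2 f
    rw [mem_pairsAtDist.1 he] at h1
    have h2 : ((subcube e.1 e.2).filter (fun z => z ∉ t)).card ≤ (B e t).card + 2 := by
      have := Finset.le_card_sdiff {e.1, e.2} ((subcube e.1 e.2).filter (fun z => z ∉ t))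
      have h3 : ({e.1, e.2} : Finset (Fin n → Bool)).card ≤ 2 := Finset.card_le_two
      simp only [B]
      omega
    simp_rw [hf] at h2
    simp only [v] at h2
    -- For `d = 0` the truncated subtractions make the exponent 0.
    have h4 : 2 ^ d ≥ 2 * 2 ^ (d - 1) ∨ d = 0 := by
      rcases d with _ | d
      · exact Or.inr rfl
      · left
        rw [Nat.add_sub_cancel, pow_succ, mul_comm]
    rcases h4 with h4 | h4
    · omega
    · simp [h4]
  have he : ∀ e ∈ pairsAtDist n d, (randomCubeSubset n p).real
      {Q | ∃ t ∈ halfSpaceTraces (v e), ∀ z ∈ B e t, z ∉ Q} ≤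
      ((n + 1) * (2 ^ n) ^ n) * (1 - (p : ℝ)) ^ (2 ^ (d - 1) - 2) := by
    intro e he
    refine (measureReal_exists_mem_le _ _ _).trans ((Finset.sum_le_sum (ht e he)).trans ?_)
    rw [Finset.sum_const, nsmul_eq_mul]
    refine mul_le_mul_of_nonneg_right ?_ (pow_nonneg hp0 _)
    have := card_halfSpaceTraces_le (v e)
    simp only [Module.finrank_fintype_fun_eq_card, Fintype.card_fin, Fintype.card_fun,
      Fintype.card_bool] at this
    exact_mod_cast this
  refine (measureReal_mono hsub).trans ((measureReal_exists_mem_le _ _ _).trans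
    ((Finset.sum_le_sum he).trans ?_))
  rw [Finset.sum_const, nsmul_eq_mul, mul_assoc (4 ^ n)]
  refine mul_le_mul_of_nonneg_right ?_ (mul_nonneg (by positivity) (pow_nonneg hp0 _))
  refine (Nat.cast_le.2 (Finset.card_filter_le _ _)).trans (le_of_eq ?_)
  simp [← mul_pow]

lemma prob_clique_le {d : ℕ} (hd : 1 ≤ d) (hdn : d ≤ n) (hp : 0 < (p : ℝ)) :
    (randomCubeSubset n p).real {Q | polytopeGraph (zeroOnePolytope Q) = ⊤} ≤
      4 / (2 ^ n * p) + 2 / (2 ^ n * n.choose d * (p : ℝ) ^ 2) +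
      4 ^ n * ((n + 1) * (2 ^ n) ^ n) * (1 - (p : ℝ)) ^ (2 ^ (d - 1) - 2) := by
  refine le_trans ?_ (add_le_add (prob_no_pair_at_dist_le (n := n) p hd hdn hp)
    (prob_missed_crossing_le (n := n) p d))
  refine le_trans (measureReal_mono ?_) (measureReal_union_le _ _)
  intro Q hQ
  rw [Set.mem_ofPred_eq, polytopeGraph_eq_top_iff] at hQ
  by_cases h : ∀ x ∈ Q, ∀ y ∈ Q, hammingDist x y ≠ d
  · exact Or.inl h
  · push Not at h
    obtain ⟨x, hx, y, hy, hxy⟩ := h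
    refine Or.inr ⟨x, hx, y, hy, hxy, hQ x hx y hy ?_⟩
    rintro rfl
    rw [hammingDist_self] at hxy
    omega

end Cube

/-! ### Entropy bounds for Hamming balls and binomial coefficients. -/

lemma one_add_odds_eq {δ : ℝ} (h0 : 0 < δ) (h1 : δ < 1) :
    1 + δ / (1 - δ) = (δ / (1 - δ)) ^ δ * (2 : ℝ) ^ binaryEntropy δ := by
  have h1' : 0 < 1 - δ := by linarith
  have h2 : Real.log 2 ≠ 0 := (Real.log_pos (by norm_num)).ne'
  refine Real.log_injOn_pos (by rw [Set.mem_Ioi]; positivity) (by rw [Set.mem_Ioi]; positivity) ?_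
  have e : 1 + δ / (1 - δ) = (1 - δ)⁻¹ := by
    field_simp
    ring
  rw [e, Real.log_mul (by positivity) (by positivity), Real.log_rpow (by positivity),
    Real.log_rpow (by positivity), Real.log_inv, Real.log_div h0.ne' h1'.ne',
    binaryEntropy_eq_div, div_mul_cancel₀ _ h2, Real.binEntropy, Real.log_inv, Real.log_inv]
  ring

/-- Chernoff's bound: weight each `y` by `θ ^ hammingDist x y` with `θ` the odds of `δ`, the tilt
for which `one_add_odds_eq` yields exactly the entropy. -/
lemma card_filter_le_hammingDist_le {δ : ℝ} (h0 : 1 / 2 < δ) (h1 : δ < 1) {n : ℕ}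
    (x : Fin n → Bool) :
    ((Finset.univ.filter (fun y => δ * n ≤ hammingDist x y)).card : ℝ) ≤
      ((2 : ℝ) ^ binaryEntropy δ) ^ n := by
  have h1' : 0 < 1 - δ := by linarith
  set θ := δ / (1 - δ) with hθ
  have hθ1 : 1 ≤ θ := by
    rw [hθ, le_div_iff₀ h1']
    linarith
  have hpos : 0 < θ ^ (δ * n) := by positivity
  rw [← mul_le_mul_iff_left₀ hpos]
  calc ((Finset.univ.filter (fun y => δ * n ≤ hammingDist x y)).card : ℝ) * θ ^ (δ * n)
      = ∑ y ∈ Finset.univ.filter (fun y => δ * n ≤ hammingDist x y), θ ^ (δ * n) := by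
        rw [Finset.sum_const, nsmul_eq_mul]
    _ ≤ ∑ y ∈ Finset.univ.filter (fun y => δ * n ≤ hammingDist x y), θ ^ hammingDist x y := by
        refine Finset.sum_le_sum fun y hy => ?_
        rw [← Real.rpow_natCast θ (hammingDist x y)]
        exact Real.rpow_le_rpow_of_exponent_le hθ1 (Finset.mem_filter.1 hy).2
    _ ≤ ∑ y, θ ^ hammingDist x y :=
        Finset.sum_le_sum_of_subset_of_nonneg (Finset.subset_univ _) fun _ _ _ => by positivity
    _ = ((2 : ℝ) ^ binaryEntropy δ) ^ n * θ ^ (δ * n) := by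
        rw [sum_pow_hammingDist, one_add_odds_eq (by linarith) h1, mul_pow, mul_comm,
          Real.rpow_mul (by positivity), Real.rpow_natCast]

/-- The ratio of consecutive terms is `(n - k) θ / (k + 1)`, which is at least 1 exactly when `k + 1
≤ (n + 1) δ`; so the terms rise up to the floor and fall after it. -/
lemma choose_mul_pow_le_choose_floor_mul_pow {δ : ℝ} (h0 : 0 < δ) (h1 : δ < 1) (n k : ℕ) :
    n.choose k * (δ / (1 - δ)) ^ k ≤
      n.choose ⌊(n + 1) * δ⌋₊ * (δ / (1 - δ)) ^ ⌊(n + 1) * δ⌋₊ := by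
  have h1' : 0 < 1 - δ := by linarith
  set θ := δ / (1 - δ) with hθ
  have hθ0 : 0 < θ := by positivity
  set d := ⌊(n + 1) * δ⌋₊ with hd
  have hrec : ∀ k : ℕ, k ≤ n →
      (n.choose (k + 1) * θ ^ (k + 1)) * (k + 1) = n.choose k * θ ^ k * ((n - k) * θ) := by
    intro k hk
    have := Nat.choose_succ_right_eq n k
    have h' : (n.choose (k + 1) : ℝ) * (k + 1) = n.choose k * (n - k) := by
      rw [← Nat.cast_sub hk]
      exact_mod_cast this
    calc (n.choose (k + 1) * θ ^ (k + 1)) * (k + 1)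
        = (n.choose (k + 1) : ℝ) * (k + 1) * θ ^ (k + 1) := by ring
      _ = _ := by rw [h']; ring
  rcases le_total k d with hkd | hkd
  · refine Nat.decreasingInduction' (P := fun k => n.choose k * θ ^ k ≤ n.choose d * θ ^ d)
      (fun j hj _ ih => le_trans ?_ ih) hkd le_rfl
    have hj1 : ((j + 1 : ℕ) : ℝ) ≤ (n + 1) * δ :=
      (Nat.le_floor_iff (by positivity)).1 (Nat.succ_le_of_lt hj)
    have hjn : j ≤ n := by
      have : ((j + 1 : ℕ) : ℝ) ≤ (n + 1 : ℕ) := by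
        push_cast at hj1 ⊢
        nlinarith
      have := Nat.cast_le.1 this
      omega
    push_cast at hj1
    have hratio : (j + 1 : ℝ) ≤ (n - j) * θ := by
      rw [hθ, mul_div_assoc', le_div_iff₀ h1']
      nlinarith
    have hj0 : (0 : ℝ) < j + 1 := by positivity
    rw [← mul_le_mul_iff_left₀ hj0, hrec j hjn]
    exact mul_le_mul_of_nonneg_left hratio (by positivity)
  · induction k, hkd using Nat.le_induction with
    | base => exact le_rfl
    | succ j hj ih =>
      refine le_trans ?_ ih
      rcases lt_or_ge n j with hn | hn
      · rw [Nat.choose_eq_zero_of_lt (by omega : n < j + 1), Nat.cast_zero, zero_mul]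
        positivity
      · have hj1 : (n + 1) * δ < ((j + 1 : ℕ) : ℝ) :=
          (Nat.floor_lt (by positivity)).1 (Nat.lt_succ_of_le hj)
        push_cast at hj1
        have hratio : (n - j) * θ ≤ (j + 1 : ℝ) := by
          rw [hθ, mul_div_assoc', div_le_iff₀ h1']
          nlinarith
        have hj0 : (0 : ℝ) < j + 1 := by positivity
        rw [← mul_le_mul_iff_left₀ hj0, hrec j hn]
        exact mul_le_mul_of_nonneg_left hratio (by positivity)

/-- The largest of the `n + 1` terms of `(1 + θ) ^ n` is at least their average. The extra `θ` pays
for rounding, as `d ≤ δ n + 1`. -/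
lemma two_rpow_binaryEntropy_pow_le_choose {δ : ℝ} (h0 : 1 / 2 < δ) (h1 : δ < 1) (n : ℕ) :
    ((2 : ℝ) ^ binaryEntropy δ) ^ n ≤ (n + 1) * (δ / (1 - δ)) * n.choose ⌊(n + 1) * δ⌋₊ := by
  have h1' : 0 < 1 - δ := by linarith
  have hmax := choose_mul_pow_le_choose_floor_mul_pow (by linarith : 0 < δ) h1 n
  have hent := one_add_odds_eq (by linarith : 0 < δ) h1
  set θ := δ / (1 - δ) with hθ
  have hθ1 : 1 ≤ θ := by
    rw [hθ, le_div_iff₀ h1']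
    linarith
  set d := ⌊(n + 1) * δ⌋₊ with hd
  have hsum : (1 + θ) ^ n ≤ (n + 1) * (n.choose d * θ ^ d) := by
    rw [add_comm, add_pow]
    calc ∑ m ∈ Finset.range (n + 1), θ ^ m * 1 ^ (n - m) * (n.choose m)
        ≤ ∑ _m ∈ Finset.range (n + 1), n.choose d * θ ^ d := by
          refine Finset.sum_le_sum fun m _ => ?_
          rw [one_pow, mul_one, mul_comm]
          exact hmax m
      _ = _ := by simp
  have hdle : (d : ℝ) ≤ (n + 1) * δ := Nat.floor_le (by positivity)
  have hθd : θ ^ d ≤ θ ^ (δ * n) * θ := by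
    rw [← Real.rpow_natCast, ← Real.rpow_add_one (by positivity)]
    refine Real.rpow_le_rpow_of_exponent_le hθ1 ?_
    nlinarith
  have hpos : 0 < θ ^ (δ * n) := by positivity
  rw [← mul_le_mul_iff_right₀ hpos]
  calc θ ^ (δ * n) * ((2 : ℝ) ^ binaryEntropy δ) ^ n = (1 + θ) ^ n := by
        rw [hent, mul_pow, Real.rpow_mul (by positivity), Real.rpow_natCast]
    _ ≤ (n + 1) * (n.choose d * (θ ^ (δ * n) * θ)) := hsum.trans (by gcongr)
    _ = _ := by ring

/-! ### Asymptotics on both sides of the threshold. -/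

lemma tendsto_measure_one_of_tendsto_compl {Ω : ℕ → Type*} [∀ n, MeasurableSpace (Ω n)]
    [∀ n, DiscreteMeasurableSpace (Ω n)] (μ : ∀ n, Measure (Ω n)) [∀ n, IsProbabilityMeasure (μ n)]
    (A : ∀ n, Set (Ω n)) (h : Tendsto (fun n => (μ n).real (A n)ᶜ) atTop (𝓝 0)) :
    Tendsto (fun n => μ n (A n)) atTop (𝓝 1) := by
  have h1 : ∀ n, μ n (A n) = ENNReal.ofReal (1 - (μ n).real (A n)ᶜ) := by
    intro n
    rw [probReal_compl_eq_one_sub (.of_discrete), sub_sub_cancel, ofReal_measureReal]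
  simp_rw [h1]
  have := ENNReal.tendsto_ofReal (h.const_sub 1)
  simpa using this

lemma tendsto_prob_clique {δ ε : ℝ} (h0 : 3 / 4 < δ) (h1 : δ < 1)
    (hH : binaryEntropy δ = 2 * δ - 1) (hε0 : 0 < ε) (hε1 : ε ≤ 1) (p : ℕ → unitInterval)
    (hp : ∀ᶠ n in atTop, (p n : ℝ) ≤ ((1 - ε) * (2 : ℝ) ^ (-δ)) ^ n) :
    Tendsto (fun n => randomCubeSubset n (p n) {Q | polytopeGraph (zeroOnePolytope Q) = ⊤})
      atTop (𝓝 1) := by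
  apply tendsto_measure_one_of_tendsto_compl
  set b : ℝ := (2 : ℝ) ^ (-δ) with hb
  have hb0 : 0 < b := by positivity
  have hbi : (2 : ℝ) ^ δ = b⁻¹ := by rw [hb, Real.rpow_neg (by norm_num), inv_inv]
  -- The only use of the equation defining `δ`: the exponents sum to `1 + (2δ - 1) - 2δ = 0`.
  have hN : 2 * (2 : ℝ) ^ binaryEntropy δ * b ^ 2 = 1 := by
    rw [hH, Real.rpow_sub (by norm_num), Real.rpow_one, mul_comm 2 δ, Real.rpow_mul (by norm_num),
      hbi, Real.rpow_two]
    field_simp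
  -- `δ > 3/4` gives `b ^ 4 < 1/8`, beating the `6 ^ n` from summing `2 ^ d` over pairs.
  have hb6 : 6 * b ^ 4 < 1 := by
    have h8 : b ^ 4 < 1 / 8 := by
      rw [hb, ← Real.rpow_natCast, ← Real.rpow_mul (by norm_num)]
      rw [show (1 / 8 : ℝ) = 2 ^ (-3 : ℝ) by norm_num [Real.rpow_neg]]
      refine Real.rpow_lt_rpow_of_exponent_lt (by norm_num) ?_
      push_cast
      linarith
    linarith
  -- `k` is independent of `n` and makes `4 * (1 - ε) ^ k < 1`, which absorbs the `4 ^ n` pairs.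
  obtain ⟨k, hk⟩ := exists_pow_lt_of_lt_one (by norm_num : (0 : ℝ) < 1 / 4)
    (by linarith : 1 - ε < 1)
  set K : ℝ := ∑ m ∈ Finset.range k, (2 ^ 2 ^ (m + 1) * 2 ^ 2 ^ (m + 1) : ℝ) with hK
  have hK0 : 0 ≤ K := Finset.sum_nonneg fun _ _ => by positivity
  have hε : 0 ≤ 1 - ε := by linarith
  have hlim : Tendsto (fun n : ℕ => ((1 - ε) ^ 2) ^ n + (4 * (1 - ε) ^ k) ^ n + K * (6 * b ^ 4) ^ n)
      atTop (𝓝 0) := by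
    have t1 : Tendsto (fun n : ℕ => ((1 - ε) ^ 2) ^ n) atTop (𝓝 0) :=
      tendsto_pow_atTop_nhds_zero_of_lt_one (by positivity) (by nlinarith)
    have t2 : Tendsto (fun n : ℕ => (4 * (1 - ε) ^ k) ^ n) atTop (𝓝 0) :=
      tendsto_pow_atTop_nhds_zero_of_lt_one (by positivity) (by linarith)
    have t3 : Tendsto (fun n : ℕ => (6 * b ^ 4) ^ n) atTop (𝓝 0) :=
      tendsto_pow_atTop_nhds_zero_of_lt_one (by positivity) hb6
    simpa using (t1.add t2).add (t3.const_mul K)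
  refine squeeze_zero' (Eventually.of_forall fun n => measureReal_nonneg) ?_ hlim
  filter_upwards [hp] with n hn
  have hp0 : (0 : ℝ) ≤ p n := (p n).2.1
  refine (prob_not_clique_le (n := n) (p n) (δ * n) k (((2 : ℝ) ^ binaryEntropy δ) ^ n)
    ((1 - ε) ^ n) (card_filter_le_hammingDist_le (by linarith) h1) (by positivity)
    (pow_le_one₀ hε (by linarith)) ?_).trans ?_
  · intro d hd
    have h2d : (2 : ℝ) ^ d ≤ b⁻¹ ^ n := by
      rw [← hbi, ← Real.rpow_natCast, ← Real.rpow_natCast, ← Real.rpow_mul (by norm_num)]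
      exact Real.rpow_le_rpow_of_exponent_le (by norm_num) hd.le
    calc (2 : ℝ) ^ d * (p n : ℝ) ≤ b⁻¹ ^ n * ((1 - ε) * b) ^ n := by gcongr
      _ = (1 - ε) ^ n := by
        rw [← mul_pow]
        field_simp
  · refine add_le_add (add_le_add ?_ (le_of_eq ?_)) ?_
    · calc 2 ^ n * ((2 : ℝ) ^ binaryEntropy δ) ^ n * (p n : ℝ) ^ 2
          ≤ 2 ^ n * ((2 : ℝ) ^ binaryEntropy δ) ^ n * (((1 - ε) * b) ^ n) ^ 2 := by gcongr
        _ = ((2 * (2 : ℝ) ^ binaryEntropy δ * b ^ 2) * (1 - ε) ^ 2) ^ n := by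
          rw [← pow_mul, mul_comm n 2, pow_mul, ← mul_pow, ← mul_pow]
          ring_nf
        _ = ((1 - ε) ^ 2) ^ n := by rw [hN, one_mul]
    · rw [mul_pow, ← pow_mul, ← pow_mul, mul_comm n k]
    · refine mul_le_mul_of_nonneg_left ?_ hK0
      calc 6 ^ n * (p n : ℝ) ^ 4 ≤ 6 ^ n * (b ^ n) ^ 4 := by
            gcongr
            refine hn.trans (pow_le_pow_left₀ (by positivity) ?_ n)
            nlinarith
        _ = (6 * b ^ 4) ^ n := by rw [mul_pow, ← pow_mul, ← pow_mul, mul_comm n 4]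

lemma tendsto_exp_quadratic_sub_pow {r : ℝ} (hr : 1 < r) :
    Tendsto (fun n : ℕ => Real.exp ((n : ℝ) ^ 2 + 3 * n + 2 - r ^ n / 4)) atTop (𝓝 0) := by
  have h1 := tendsto_pow_const_div_const_pow_of_one_lt 2 hr
  have h2 : Tendsto (fun n : ℕ => Real.exp (-(n : ℝ))) atTop (𝓝 0) :=
    Real.tendsto_exp_neg_atTop_nhds_zero.comp tendsto_natCast_atTop_atTop
  refine squeeze_zero' (Eventually.of_forall fun n => (Real.exp_pos _).le) ?_ h2
  -- With `r ^ n / 4 > 7 n ^ 2`, the exponent is at most `-n` once `n ^ 2 + 4 n + 2 ≤ 7 n ^ 2`, true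
  -- for `n ≥ 1`.
  filter_upwards [h1.eventually (gt_mem_nhds (by norm_num : (0 : ℝ) < 1 / 28)),
    eventually_ge_atTop 1] with n hn hn1
  have hn1' : (1 : ℝ) ≤ n := by exact_mod_cast hn1
  rw [div_lt_iff₀ (by positivity)] at hn
  refine Real.exp_le_exp.2 ?_
  nlinarith

lemma tendsto_prob_not_clique {δ ε : ℝ} (h0 : 3 / 4 < δ) (h1 : δ < 1)
    (hH : binaryEntropy δ = 2 * δ - 1) (hε0 : 0 < ε) (p : ℕ → unitInterval)
    (hp : ∀ᶠ n in atTop, ((1 + ε) * (2 : ℝ) ^ (-δ)) ^ n ≤ (p n : ℝ)) :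
    Tendsto (fun n => randomCubeSubset n (p n) {Q | polytopeGraph (zeroOnePolytope Q) ≠ ⊤})
      atTop (𝓝 1) := by
  apply tendsto_measure_one_of_tendsto_compl
  have h1' : 0 < 1 - δ := by linarith
  set b : ℝ := (2 : ℝ) ^ (-δ) with hb
  have hb0 : 0 < b := by positivity
  have hbi : (2 : ℝ) ^ δ = b⁻¹ := by rw [hb, Real.rpow_neg (by norm_num), inv_inv]
  have hN : 2 * (2 : ℝ) ^ binaryEntropy δ * b ^ 2 = 1 := by
    rw [hH, Real.rpow_sub (by norm_num), Real.rpow_one, mul_comm 2 δ, Real.rpow_mul (by norm_num),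
      hbi, Real.rpow_two]
    field_simp
  have hb2 : 1 ≤ 2 * b := by
    have : (2 : ℝ) ^ (-1 : ℝ) ≤ b := Real.rpow_le_rpow_of_exponent_le (by norm_num) (by linarith)
    rw [Real.rpow_neg_one] at this
    linarith
  set θ := δ / (1 - δ) with hθ
  have hθ0 : 0 < θ := by
    have : 0 < δ := by linarith
    positivity
  set r := 1 + ε with hr
  have hr1 : 1 < r := by linarith
  have hlim : Tendsto (fun n : ℕ => 4 * (r⁻¹) ^ n + 2 * θ * ((n + 1) * (r⁻¹) ^ n) +
      Real.exp ((n : ℝ) ^ 2 + 3 * n + 2 - r ^ n / 4)) atTop (𝓝 0) := by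
    have hr0 : |r⁻¹| < 1 := by
      rw [abs_of_pos (by positivity)]
      exact inv_lt_one_of_one_lt₀ hr1
    have t1 : Tendsto (fun n : ℕ => (r⁻¹) ^ n) atTop (𝓝 0) :=
      tendsto_pow_atTop_nhds_zero_of_abs_lt_one hr0
    have t2 : Tendsto (fun n : ℕ => (n : ℝ) * (r⁻¹) ^ n) atTop (𝓝 0) :=
      tendsto_self_mul_const_pow_of_abs_lt_one hr0
    have t3 : Tendsto (fun n : ℕ => ((n : ℝ) + 1) * (r⁻¹) ^ n) atTop (𝓝 0) := by
      simpa [add_mul] using t2.add t1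
    simpa using ((t1.const_mul 4).add (t3.const_mul (2 * θ))).add
      (tendsto_exp_quadratic_sub_pow hr1)
  refine squeeze_zero' (Eventually.of_forall fun n => measureReal_nonneg) ?_ hlim
  filter_upwards [hp, eventually_ge_atTop 1] with n hn hn1
  have hn1' : (1 : ℝ) ≤ n := by exact_mod_cast hn1
  have hrb : 0 < (r * b) ^ n := by positivity
  have hp0 : (0 : ℝ) < p n := hrb.trans_le hn
  have hp1 : (p n : ℝ) ≤ 1 := (p n).2.2
  set d := ⌊((n : ℝ) + 1) * δ⌋₊ with hd
  have hd1 : 1 ≤ d := Nat.le_floor (by push_cast; nlinarith)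
  have hdn : d ≤ n := by
    have : d < n + 1 := (Nat.floor_lt (by nlinarith)).2 (by push_cast; nlinarith)
    omega
  have hC := two_rpow_binaryEntropy_pow_le_choose (by linarith : 1 / 2 < δ) h1 n
  rw [← hd, ← hθ] at hC
  have hCpos : (0 : ℝ) < n.choose d := by exact_mod_cast Nat.choose_pos hdn
  have hset : {Q : Set (Fin n → Bool) | polytopeGraph (zeroOnePolytope Q) ≠ ⊤}ᶜ =
      {Q | polytopeGraph (zeroOnePolytope Q) = ⊤} := by
    ext Q
    simp
  rw [hset]
  refine (prob_clique_le (n := n) (p n) hd1 hdn hp0).trans ?_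
  refine add_le_add (add_le_add ?_ ?_) ?_
  · rw [div_eq_mul_inv, inv_pow]
    refine mul_le_mul_of_nonneg_left (inv_anti₀ (by positivity) ?_) (by norm_num)
    calc r ^ n ≤ (2 * b) ^ n * r ^ n := le_mul_of_one_le_left (by positivity) (one_le_pow₀ hb2)
      _ = 2 ^ n * (r * b) ^ n := by
        rw [← mul_pow, ← mul_pow]
        ring_nf
      _ ≤ 2 ^ n * p n := by gcongr
  · have hkey : r ^ n ≤ (n + 1) * θ * (2 ^ n * n.choose d * (p n : ℝ) ^ 2) := by
      calc r ^ n ≤ (r ^ 2) ^ n := pow_le_pow_left₀ (by positivity) (by nlinarith) n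
        _ = ((2 * (2 : ℝ) ^ binaryEntropy δ * b ^ 2) * r ^ 2) ^ n := by rw [hN, one_mul]
        _ = ((2 : ℝ) ^ binaryEntropy δ) ^ n * 2 ^ n * ((r * b) ^ n) ^ 2 := by
          rw [← pow_mul, mul_comm n 2, pow_mul, ← mul_pow, ← mul_pow]
          ring_nf
        _ ≤ ((n + 1) * θ * n.choose d) * 2 ^ n * (p n : ℝ) ^ 2 := by gcongr
        _ = _ := by ring
    have hr0 : 0 < r ^ n := by positivity
    rw [inv_pow, div_le_iff₀ (by positivity)]
    calc (2 : ℝ) = 2 * (r ^ n)⁻¹ * r ^ n := by field_simp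
      _ ≤ 2 * (r ^ n)⁻¹ * ((n + 1) * θ * (2 ^ n * n.choose d * (p n : ℝ) ^ 2)) := by gcongr
      _ = _ := by ring
  · have h4 : (4 : ℝ) ^ n ≤ Real.exp (2 * n) := by
      rw [mul_comm, Real.exp_nat_mul]
      refine pow_le_pow_left₀ (by norm_num) ?_ n
      have := Real.quadratic_le_exp_of_nonneg (by norm_num : (0 : ℝ) ≤ 2)
      linarith
    have hn2 : (n + 1 : ℝ) ≤ Real.exp n := Real.add_one_le_exp _
    have h2 : ((2 : ℝ) ^ n) ^ n ≤ Real.exp ((n : ℝ) ^ 2) := by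
      rw [← pow_mul, sq, ← Nat.cast_mul, ← mul_one ((n * n : ℕ) : ℝ), Real.exp_nat_mul]
      refine pow_le_pow_left₀ (by norm_num) ?_ _
      have := Real.add_one_le_exp 1
      linarith
    have hdp : r ^ n / 4 ≤ 2 ^ (d - 1) * (p n : ℝ) := by
      have hfl : ((n : ℝ) + 1) * δ < d + 1 := Nat.lt_floor_add_one _
      -- `δ n ≤ (n + 1) δ < d + 1`; the factor 4 covers the gap between `d + 1` and `d - 1`.
      have h2d : b⁻¹ ^ n ≤ 4 * 2 ^ (d - 1) := by
        have e : (4 : ℝ) * 2 ^ (d - 1) = 2 ^ (d + 1) := by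
          rw [show d + 1 = d - 1 + 2 by omega, pow_add]
          norm_num
          ring
        rw [e, ← hbi, ← Real.rpow_natCast, ← Real.rpow_natCast, ← Real.rpow_mul (by norm_num)]
        refine Real.rpow_le_rpow_of_exponent_le (by norm_num) ?_
        push_cast
        nlinarith
      calc r ^ n / 4 = b⁻¹ ^ n * (r * b) ^ n / 4 := by
            rw [← mul_pow]
            field_simp
        _ ≤ (4 * 2 ^ (d - 1)) * (p n : ℝ) / 4 := by gcongr
        _ = _ := by ring
    have hexp : (1 - (p n : ℝ)) ^ (2 ^ (d - 1) - 2) ≤ Real.exp (2 - r ^ n / 4) := by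
      calc (1 - (p n : ℝ)) ^ (2 ^ (d - 1) - 2)
          ≤ (Real.exp (-(p n : ℝ))) ^ (2 ^ (d - 1) - 2) :=
            pow_le_pow_left₀ (by linarith) (Real.one_sub_le_exp_neg _) _
        _ = Real.exp (((2 ^ (d - 1) - 2 : ℕ) : ℝ) * -(p n : ℝ)) := by rw [Real.exp_nat_mul]
        _ ≤ Real.exp (2 - r ^ n / 4) := by
          refine Real.exp_le_exp.2 ?_
          have : (2 : ℝ) ^ (d - 1) - 2 ≤ ((2 ^ (d - 1) - 2 : ℕ) : ℝ) := by
            rw [sub_le_iff_le_add]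
            exact_mod_cast (by omega : 2 ^ (d - 1) ≤ 2 ^ (d - 1) - 2 + 2)
          nlinarith
    calc (4 : ℝ) ^ n * ((n + 1) * (2 ^ n) ^ n) * (1 - (p n : ℝ)) ^ (2 ^ (d - 1) - 2)
        ≤ Real.exp (2 * n) * (Real.exp n * Real.exp ((n : ℝ) ^ 2)) * Real.exp (2 - r ^ n / 4) := by
          have : 0 ≤ 1 - (p n : ℝ) := by linarith
          gcongr
      _ = Real.exp ((n : ℝ) ^ 2 + 3 * n + 2 - r ^ n / 4) := by
          rw [← Real.exp_add, ← Real.exp_add, ← Real.exp_add]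
          ring_nf

theorem theorem2 :
    (∃! δ : ℝ, δ ∈ Set.Ioc (1 / 2 : ℝ) 1 ∧ binaryEntropy δ = 2 * δ - 1) ∧
    ∀ δ : ℝ, δ ∈ Set.Ioc (1 / 2 : ℝ) 1 → binaryEntropy δ = 2 * δ - 1 →
      |δ - 0.8295| < 0.00005 ∧
      ∀ ε : ℝ, 0 < ε → ∀ p : ℕ → unitInterval,
        (ε ≤ 1 →
          (∀ᶠ n in atTop, (p n : ℝ) ≤ ((1 - ε) * (2 : ℝ) ^ (-δ)) ^ n) →
          Tendsto (fun n => randomCubeSubset n (p n)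
            {Q | polytopeGraph (zeroOnePolytope Q) = ⊤}) atTop (𝓝 1)) ∧
        ((∀ᶠ n in atTop, ((1 + ε) * (2 : ℝ) ^ (-δ)) ^ n ≤ (p n : ℝ)) →
          Tendsto (fun n => randomCubeSubset n (p n)
            {Q | polytopeGraph (zeroOnePolytope Q) ≠ ⊤}) atTop (𝓝 1)) := by
  refine ⟨existsUnique_binaryEntropy_eq, fun δ hδ hH => ?_⟩
  have habs := abs_sub_lt_of_binaryEntropy_eq hδ hH
  rw [abs_lt] at habs
  norm_num at habs
  have h0 : 3 / 4 < δ := by linarith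
  have h1 : δ < 1 := by linarith
  exact ⟨abs_sub_lt_of_binaryEntropy_eq hδ hH, fun ε hε p =>
    ⟨fun hε1 hp => tendsto_prob_clique h0 h1 hH hε hε1 p hp,
      fun hp => tendsto_prob_not_clique h0 h1 hH hε p hp⟩⟩
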